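/- An odd Durfee symbol of a nonnegative integer $n$ consists of an integer $D\ge 0$ and two finite, possibly empty, weakly decreasing sequences of odd positive integers, a top row $a_1\ge a_2\ge\cdots\ge a_s$ and a bottom row $b_1\ge b_2\ge\cdots\ge b_t$, with all entries at most $2D+1$, such that $$n=\sum_{i=1}^{s}a_i+\sum_{j=1}^{t}b_j+2D^2+2D+1 .$$ Its odd rank is $s-t$, the number of entries in the top row minus the number of entries in the bottom row. Let $N^0(a,M;n)$ denote the number of odd Durfee symbols of $n$ whose odd rank is congruent to $a$ modulo $M$. Theorem. For every integer $n\ge 0$, $$N^0(0,8;8n+r)=N^0(4,8;8n+r)\quad\text{for } r\in\{5,7\},$$ $$N^0(1,8;8n+r)=N^0(3,8;8n+r)\quad\text{for } r\in\{4,6\}.$$ -/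

import Mathlib

/-- An odd Durfee symbol of `n`: a nonnegative integer subscript `D` and two rows of odd positive
integers, each at most `2 * D + 1`, such that all the entries together with
`2 * D ^ 2 + 2 * D + 1` sum to `n`. A row `a₁ ≥ a₂ ≥ ⋯ ≥ aₛ` (possibly empty) is the multiset of
its entries, since a weakly decreasing finite sequence is determined by that multiset. -/
@[ext]
structure OddDurfeeSymbol (n : ℕ) where
  /-- the subscript -/
  D : ℕ
  /-- the entries of the top row -/
  top : Multiset ℕ
  /-- the entries of the bottom row -/
  bot : Multiset ℕ
  top_odd : ∀ a ∈ top, Odd a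
  bot_odd : ∀ b ∈ bot, Odd b
  top_le : ∀ a ∈ top, a ≤ 2 * D + 1
  bot_le : ∀ b ∈ bot, b ≤ 2 * D + 1
  sum_eq : top.sum + bot.sum + (2 * D ^ 2 + 2 * D + 1) = n

namespace OddDurfeeSymbol

/-- The odd rank: the number of entries in the top row minus the number in the bottom row. -/
def oddRank {n : ℕ} (s : OddDurfeeSymbol n) : ℤ :=
  (Multiset.card s.top : ℤ) - (Multiset.card s.bot : ℤ)

/-- There are only finitely many odd Durfee symbols of `n`. -/
instance (n : ℕ) : Finite (OddDurfeeSymbol n) := by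
  have key : ∀ m : Multiset ℕ, (∀ a ∈ m, Odd a) → m.sum ≤ n →
      m ≤ n • (Multiset.range (n + 1)) := by
    intro m hm hs
    rw [Multiset.le_iff_count]
    intro a
    by_cases ha : a ∈ m
    · have h1 : a ≤ m.sum := Multiset.le_sum_of_mem ha
      have h2 : Multiset.card m • 1 ≤ m.sum :=
        Multiset.card_nsmul_le_sum fun x hx => (hm x hx).pos
      have h3 := Multiset.count_le_card a m
      have h4 : 1 ≤ Multiset.count a (Multiset.range (n + 1)) :=
        Multiset.one_le_count_iff_mem.2 (Multiset.mem_range.2 (by omega))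
      rw [Multiset.count_nsmul]
      have h5 : n * 1 ≤ n * Multiset.count a (Multiset.range (n + 1)) :=
        Nat.mul_le_mul_left n h4
      simp only [smul_eq_mul, mul_one] at h2
      omega
    · simp [Multiset.count_eq_zero_of_notMem ha]
  let B : Multiset ℕ := n • Multiset.range (n + 1)
  let f : OddDurfeeSymbol n → Finset.range (n + 1) × Set.Iic B × Set.Iic B := fun s =>
    (⟨s.D, by have := s.sum_eq; rw [Finset.mem_range]; omega⟩,
      ⟨s.top, key _ s.top_odd (by have := s.sum_eq; omega)⟩,
      ⟨s.bot, key _ s.bot_odd (by have := s.sum_eq; omega)⟩)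
  have : Finite (Set.Iic B) := (Set.finite_Iic B).to_subtype
  refine Finite.of_injective f fun s t h => ?_
  simp only [f, Prod.mk.injEq] at h
  exact OddDurfeeSymbol.ext (congrArg Subtype.val h.1) (congrArg Subtype.val h.2.1)
    (congrArg Subtype.val h.2.2)

end OddDurfeeSymbol

/-- `N⁰(a, M; n)`: the number of odd Durfee symbols of `n` with odd rank congruent to `a`
modulo `M`. -/
noncomputable def oddRankCount (a M : ℤ) (n : ℕ) : ℕ :=
  Nat.card {s : OddDurfeeSymbol n // s.oddRank ≡ a [ZMOD M]}

/-! Write ζ for `zeta8`, χ for the odd character modulo 4, and N_a for the number of symbols of n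
with rank congruent to a modulo 8. Everything rests on `OddDurfeeSymbol.rankSum_eq_zero`: the sum of
ζ^rank over the symbols of n vanishes when n % 8 ≥ 4. Its real part is N_0 - N_4 + (√2/2)(N_1 + N_7
- N_3 - N_5). The rank has the parity of n + 1, so one of the two brackets is empty, and exchanging
the rows gives N_7 = N_1 and N_5 = N_3.

With q = s^2, the generating function divided by s is R(s) = ∑_D q^(D^2+D) / ∏_{k ≤ D} (1 + q^(2k+1)
- q^k y), where y = √2 s. Partial fractions in y (`prod_inv_eq_sum`) and an interchange of Bailey
type (`hasSum_bailey`) give `durfeeSum q 0` times a single sum over k; `durfeeSum_mul_pentSum`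
identifies the inverse of that factor as a pentagonal series. Since y^2 = 2q, rationalising the
denominators splits R into `evenLambert` and y times `oddLambert`.

Up to a theta series, both Lambert sums are Appell-type series of degree three at u = q. The series
∑ χ(l) u^l / (1 - q^(4l)) has simple poles at u = ±i q^(4m). Multiply it by a theta function of
degree three; a suitable multiple of the Appell series cancels the poles, and the difference is
again such a theta function, hence known from three coefficients. On Laurent coefficients this is
the recursion X(n+3) = q^(4n+h) X(n), and no complex analysis is needed (`epsConv_mul_sub_appell`).
Choosing the theta function odd under a reflection fixes enough of the three coefficients, and its
value at u = q is -q⁻¹ `pentSum q`, which cancels `durfeeSum q 0`.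

So R is a sum of four explicit functions (`hasSum_rankComponent`). Under s ↦ ζs, that is q ↦ iq,
they are multiplied by ζ^0, ζ^2, ζ^1, ζ^7. Only exponents n ≡ 0, 1, 2, 7 modulo 8 can therefore
occur in R, whose coefficient at s^n belongs to the symbols of n + 1. -/

/-! ### Summability over ℤ and ℤ × ℤ -/

theorem summable_natAbs_pow {r : ℝ} (h0 : 0 < r) (h1 : r < 1) :
    Summable fun k : ℤ => r ^ k.natAbs := by
  refine Summable.of_nat_of_neg ?_ ?_ <;>
    simpa using summable_geometric_of_lt_one h0.le h1

theorem summable_zpow_of_abs_le {r : ℝ} (h0 : 0 < r) (h1 : r < 1) {f : ℤ → ℤ} (C : ℤ)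
    (hf : ∀ k, |k| - C ≤ f k) : Summable fun k => r ^ f k := by
  refine Summable.of_nonneg_of_le (fun k => (zpow_pos h0 _).le) (fun k => ?_)
    ((summable_natAbs_pow h0 h1).mul_left (r ^ (-C)))
  calc r ^ f k ≤ r ^ (|k| - C) := zpow_le_zpow_right_of_le_one₀ h0 h1.le (hf k)
    _ = r ^ (-C) * r ^ k.natAbs := by
      rw [← zpow_natCast, Int.natCast_natAbs, ← zpow_add₀ h0.ne']; congr 1; ring

theorem summable_zpow_prod_of_abs_le {r : ℝ} (h0 : 0 < r) (h1 : r < 1) {f : ℤ × ℤ → ℤ} (C : ℤ)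
    (s : Set (ℤ × ℤ)) (hf : ∀ p ∈ s, |p.1| + |p.2| - C ≤ f p) :
    Summable (s.indicator fun p => r ^ f p) := by
  have hs := ((summable_natAbs_pow h0 h1).mul_of_nonneg (summable_natAbs_pow h0 h1)
    (fun k => by positivity) (fun k => by positivity)).mul_left (r ^ (-C))
  refine Summable.of_nonneg_of_le (fun p => ?_) (fun p => ?_) hs
  · exact Set.indicator_nonneg (fun p _ => (zpow_pos h0 _).le) p
  · by_cases hp : p ∈ s
    swap
    · rw [Set.indicator_of_notMem hp]; positivity
    rw [Set.indicator_of_mem hp]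
    calc r ^ f p ≤ r ^ (|p.1| + |p.2| - C) := zpow_le_zpow_right_of_le_one₀ h0 h1.le (hf p hp)
      _ = r ^ (-C) * (r ^ p.1.natAbs * r ^ p.2.natAbs) := by
        rw [← zpow_natCast, ← zpow_natCast, Int.natCast_natAbs, Int.natCast_natAbs,
          ← zpow_add₀ h0.ne', ← zpow_add₀ h0.ne']
        congr 1; ring

/-! ### Sequences of antiperiod 2 and the character modulo 4 -/

/-- The sequence on `ℤ` with values `a, b, -a, -b` on the residues `0, 1, 2, 3` modulo `4`. -/
def altSeq (a b : ℂ) (l : ℤ) : ℂ :=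
  if l % 4 = 0 then a else if l % 4 = 1 then b else if l % 4 = 2 then -a else -b

theorem altSeq_add_two (a b : ℂ) (l : ℤ) : altSeq a b (l + 2) = -altSeq a b l := by
  have h : l % 4 = 0 ∨ l % 4 = 1 ∨ l % 4 = 2 ∨ l % 4 = 3 := by omega
  unfold altSeq
  rcases h with h | h | h | h
  · have : (l + 2) % 4 = 2 := by omega
    simp [h, this]
  · have : (l + 2) % 4 = 3 := by omega
    simp [h, this]
  · have : (l + 2) % 4 = 0 := by omega
    simp [h, this]
  · have : (l + 2) % 4 = 1 := by omega
    simp [h, this]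

theorem eq_altSeq {f : ℤ → ℂ} (hf : ∀ l, f (l + 2) = -f l) (l : ℤ) :
    f l = altSeq (f 0) (f 1) l := by
  have h4 : ∀ k : ℤ, ∀ r, f (4 * k + r) = f r := by
    intro k r
    induction k using Int.induction_on with
    | zero => simp
    | succ k ih =>
      rw [← ih, show 4 * ((k : ℤ) + 1) + r = 4 * k + r + 2 + 2 by ring, hf, hf, neg_neg]
    | pred k ih =>
      rw [← ih, show 4 * (-(k : ℤ)) + r = 4 * (-k - 1) + r + 2 + 2 by ring, hf, hf, neg_neg]
  have h : l % 4 = 0 ∨ l % 4 = 1 ∨ l % 4 = 2 ∨ l % 4 = 3 := by omega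
  have e : f l = f (l % 4) := by rw [← h4 (l / 4) (l % 4)]; congr 1; omega
  rw [e]
  unfold altSeq
  rcases h with h | h | h | h <;> simp [h]
  · exact hf 0
  · exact hf 1

theorem altSeq_zero_one_neg (l : ℤ) : altSeq 0 1 (-l) = -altSeq 0 1 l := by
  have h : l % 4 = 0 ∨ l % 4 = 1 ∨ l % 4 = 2 ∨ l % 4 = 3 := by omega
  unfold altSeq
  rcases h with h | h | h | h
  · have : (-l) % 4 = 0 := by omega
    simp [h, this]
  · have : (-l) % 4 = 3 := by omega
    simp [h, this]
  · have : (-l) % 4 = 2 := by omega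
    simp [h, this]
  · have : (-l) % 4 = 1 := by omega
    simp [h, this]

theorem norm_altSeq_le (a b : ℂ) (l : ℤ) : ‖altSeq a b l‖ ≤ ‖a‖ + ‖b‖ := by
  unfold altSeq
  split_ifs <;> simp

theorem hasSum_altSeq_nat (a b : ℂ) {x : ℂ} (hx : ‖x‖ < 1) :
    HasSum (fun l : ℕ => altSeq a b l * x ^ l) ((a + b * x) / (1 + x ^ 2)) := by
  have hx2 : ‖-x ^ 2‖ < 1 := by
    rw [norm_neg, norm_pow]; exact pow_lt_one₀ (norm_nonneg _) hx two_ne_zero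
  have key : ∀ k : ℕ, ∀ c d : ℂ, altSeq c d (2 * k : ℕ) = c * (-1) ^ k := by
    intro k c d
    induction k with
    | zero => simp [altSeq]
    | succ k ih =>
      rw [show ((2 * (k + 1) : ℕ) : ℤ) = ((2 * k : ℕ) : ℤ) + 2 by push_cast; ring,
        altSeq_add_two, ih]
      ring
  have key' : ∀ k : ℕ, altSeq a b (2 * k + 1 : ℕ) = b * (-1) ^ k := by
    intro k
    induction k with
    | zero => simp [altSeq]
    | succ k ih =>
      rw [show ((2 * (k + 1) + 1 : ℕ) : ℤ) = ((2 * k + 1 : ℕ) : ℤ) + 2 by push_cast; ring,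
        altSeq_add_two, ih]
      ring
  have hg := hasSum_geometric_of_norm_lt_one hx2
  have h1 : HasSum (fun k : ℕ => altSeq a b (2 * k : ℕ) * x ^ (2 * k)) (a * (1 - -x ^ 2)⁻¹) := by
    have e : (fun k : ℕ => altSeq a b (2 * k : ℕ) * x ^ (2 * k)) =
        fun k => a * (-x ^ 2) ^ k := by
      funext k
      rw [key, neg_pow (x ^ 2), ← pow_mul]; ring
    rw [e]
    exact hg.mul_left a
  have h2 : HasSum (fun k : ℕ => altSeq a b (2 * k + 1 : ℕ) * x ^ (2 * k + 1))
      (b * x * (1 - -x ^ 2)⁻¹) := by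
    have e : (fun k : ℕ => altSeq a b (2 * k + 1 : ℕ) * x ^ (2 * k + 1)) =
        fun k => b * x * (-x ^ 2) ^ k := by
      funext k
      rw [key', neg_pow (x ^ 2), ← pow_mul]; ring
    rw [e]
    exact hg.mul_left (b * x)
  have h3 := HasSum.even_add_odd (f := fun l : ℕ => altSeq a b l * x ^ l) h1 h2
  have e : (a + b * x) / (1 + x ^ 2) = a * (1 - -x ^ 2)⁻¹ + b * x * (1 - -x ^ 2)⁻¹ := by
    rw [sub_neg_eq_add]; ring
  rw [e]
  exact h3

theorem div_one_sub_inv (c : ℂ) {x : ℂ} (hx : x ≠ 0) :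
    c / (1 - x⁻¹) = -(c * x / (1 - x)) := by
  rw [show 1 - x⁻¹ = -((1 - x) / x) by field_simp; ring, div_neg, div_div_eq_mul_div]

/-! ### The Lambert kernel -/

/-- `eps q l = χ(l) / (1 - q ^ (4 l))` with `χ` the odd character modulo `4`. -/
noncomputable def eps (q : ℂ) (l : ℤ) : ℂ := altSeq 0 1 l / (1 - q ^ (4 * l))

/-- For l < 0 the denominator has size about |q|^(-4|l|), so the kernel decays like |q|^(4|l|), more
than enough to absorb the growth |q|^(-|l|) of q^l. -/
theorem norm_eps_le {q : ℂ} (h0 : q ≠ 0) (h1 : ‖q‖ < 1) (l : ℤ) :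
    ‖eps q l‖ ≤ (1 - ‖q‖)⁻¹ ∧ ‖eps q l * q ^ l‖ ≤ (1 - ‖q‖)⁻¹ * ‖q‖ ^ l.natAbs := by
  have hr : 0 < ‖q‖ := norm_pos_iff.2 h0
  have hd : 0 < 1 - ‖q‖ := by linarith
  have hle : ∀ n : ℕ, 0 < n → 1 - ‖q‖ ≤ ‖1 - q ^ n‖ := by
    intro n hn
    calc 1 - ‖q‖ ≤ 1 - ‖q‖ ^ n := by
          have := pow_le_of_le_one hr.le h1.le hn.ne'
          linarith
      _ ≤ ‖1 - q ^ n‖ := by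
          have := norm_sub_norm_le (1 : ℂ) (q ^ n)
          simpa using this
  have halt : ‖altSeq 0 1 l‖ ≤ 1 := by simpa using norm_altSeq_le 0 1 l
  rcases lt_trichotomy l 0 with hl | hl | hl
  · obtain ⟨n, rfl⟩ : ∃ n : ℕ, l = -n := ⟨l.natAbs, by omega⟩
    have hn : 0 < n := by omega
    have e : eps q (-n) = -(altSeq 0 1 (-n) * q ^ (4 * n) / (1 - q ^ (4 * n))) := by
      have hne : (1 - q ^ (4 * n)) ≠ 0 := by
        rw [← norm_pos_iff]; exact hd.trans_le (hle _ (by omega))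
      have hq : q ^ (4 * n) ≠ 0 := pow_ne_zero _ h0
      unfold eps
      rw [show (4 * -(n : ℤ)) = -((4 * n : ℕ) : ℤ) by push_cast; ring, zpow_neg, zpow_natCast]
      rw [div_one_sub_inv _ hq]
    have hb : ‖eps q (-n)‖ ≤ (1 - ‖q‖)⁻¹ * ‖q‖ ^ (4 * n) := by
      rw [e, norm_neg, norm_div, norm_mul, norm_pow, div_eq_mul_inv, mul_comm]
      refine mul_le_mul (inv_anti₀ hd (hle _ (by omega))) ?_ (by positivity) (by positivity)
      exact mul_le_of_le_one_left (by positivity) halt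
    constructor
    · refine hb.trans (mul_le_of_le_one_right (by positivity) (pow_le_one₀ hr.le h1.le))
    · rw [norm_mul, norm_zpow, zpow_neg, zpow_natCast]
      calc _ ≤ ((1 - ‖q‖)⁻¹ * ‖q‖ ^ (4 * n)) * (‖q‖ ^ n)⁻¹ := by gcongr
        _ = (1 - ‖q‖)⁻¹ * ‖q‖ ^ (3 * n) := by
          rw [show 4 * n = 3 * n + n by ring, pow_add]; field_simp
        _ ≤ _ := by
          gcongr 1
          exact pow_le_pow_of_le_one hr.le h1.le (by simp; omega)
  · subst hl
    have : eps q 0 = 0 := by simp [eps, altSeq]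
    rw [this]; simp; exact h1.le
  · obtain ⟨n, rfl⟩ : ∃ n : ℕ, l = n := ⟨l.natAbs, by omega⟩
    have hn : 0 < n := by omega
    have hb : ‖eps q n‖ ≤ (1 - ‖q‖)⁻¹ := by
      unfold eps
      rw [show (4 * (n : ℤ)) = ((4 * n : ℕ) : ℤ) by push_cast; ring, zpow_natCast, norm_div,
        div_eq_mul_inv]
      calc _ ≤ 1 * (1 - ‖q‖)⁻¹ :=
            mul_le_mul halt (inv_anti₀ hd (hle _ (by omega))) (by positivity) zero_le_one
        _ = _ := one_mul _
    refine ⟨hb, ?_⟩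
    rw [norm_mul, norm_zpow, zpow_natCast]
    simp only [Int.natAbs_natCast]
    gcongr

theorem summable_norm_eps_mul_zpow {q : ℂ} (h0 : q ≠ 0) (h1 : ‖q‖ < 1) :
    Summable fun l => ‖eps q l * q ^ l‖ :=
  Summable.of_nonneg_of_le (fun _ => norm_nonneg _) (fun l => (norm_eps_le h0 h1 l).2)
    ((summable_natAbs_pow (norm_pos_iff.2 h0) h1).mul_left _)

/-- This is x⁻¹/(1 - x) = 1/(1 - x) + x⁻¹ with x = q^(4l). At l = 0, where the denominator vanishes,
χ(0) = 0 makes both sides zero. -/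
theorem eps_mul_zpow {q : ℂ} (h0 : q ≠ 0) (h1 : ‖q‖ < 1) (l : ℤ) :
    eps q l * q ^ (-4 * l) = eps q l + altSeq 0 1 l * q ^ (-4 * l) := by
  rcases eq_or_ne l 0 with rfl | hl
  · simp [eps, altSeq]
  · have hne : 1 - q ^ (4 * l) ≠ 0 := by
      intro h
      have h2 : ‖q‖ ^ (4 * l) = 1 := by
        rw [← norm_zpow, ← sub_eq_zero.1 h, norm_one]
      rw [zpow_eq_one_iff_right₀ (norm_nonneg _) h1.ne] at h2
      omega
    unfold eps
    rw [show -4 * l = -(4 * l) by ring, zpow_neg]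
    have := zpow_ne_zero (4 * l) h0
    field_simp
    ring

theorem eps_neg {q : ℂ} (h0 : q ≠ 0) (h1 : ‖q‖ < 1) (l : ℤ) :
    eps q (-l) = eps q l - altSeq 0 1 l := by
  rcases eq_or_ne l 0 with rfl | hl
  · simp [eps, altSeq]
  · have hne : 1 - q ^ (4 * l) ≠ 0 := by
      intro h
      have h2 : ‖q‖ ^ (4 * l) = 1 := by
        rw [← norm_zpow, ← sub_eq_zero.1 h, norm_one]
      rw [zpow_eq_one_iff_right₀ (norm_nonneg _) h1.ne] at h2
      omega
    have hp := zpow_ne_zero (4 * l) h0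
    unfold eps
    rw [altSeq_zero_one_neg, show 4 * -l = -(4 * l) by ring, zpow_neg, div_one_sub_inv _ hp]
    field_simp
    ring

/-! ### Coefficients of theta functions of degree three -/

/-- The homogeneous sequence with `X (n + 3) = q ^ (4 n + h) * X n` and initial values
`X 0 = a`, `X 1 = b`, `X 2 = c`. -/
noncomputable def thetaSeq (q : ℂ) (h : ℤ) (a b c : ℂ) (n : ℤ) : ℂ :=
  (if n % 3 = 0 then a else if n % 3 = 1 then b else c) *
    q ^ (6 * (n / 3) ^ 2 + (h - 6) * (n / 3) + 4 * (n % 3) * (n / 3))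

theorem thetaSeq_add_three {q : ℂ} (h0 : q ≠ 0) (h : ℤ) (a b c : ℂ) (n : ℤ) :
    thetaSeq q h a b c (n + 3) = q ^ (4 * n + h) * thetaSeq q h a b c n := by
  have e1 : (n + 3) % 3 = n % 3 := by omega
  have e2 : (n + 3) / 3 = n / 3 + 1 := by omega
  unfold thetaSeq
  rw [e1, e2, mul_left_comm, ← zpow_add₀ h0]
  congr 2
  have : n = 3 * (n / 3) + n % 3 := by omega
  generalize n / 3 = k at *
  generalize n % 3 = r at *
  subst this
  ring

/-- Powers of q are invertible, so the recursion runs in both directions. This stands in for the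
three-dimensionality of the space of theta functions. -/
theorem eq_thetaSeq {q : ℂ} (h0 : q ≠ 0) {h : ℤ} {X : ℤ → ℂ}
    (hX : ∀ n, X (n + 3) = q ^ (4 * n + h) * X n) (n : ℤ) :
    X n = thetaSeq q h (X 0) (X 1) (X 2) n := by
  have key : ∀ k r : ℤ, X r = thetaSeq q h (X 0) (X 1) (X 2) r →
      X (3 * k + r) = thetaSeq q h (X 0) (X 1) (X 2) (3 * k + r) := by
    intro k r hr
    induction k using Int.induction_on with
    | zero => simpa using hr
    | succ k ih =>
      rw [show 3 * ((k : ℤ) + 1) + r = 3 * k + r + 3 by ring, hX, thetaSeq_add_three h0, ih]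
    | pred k ih =>
      rw [show 3 * (-(k : ℤ)) + r = 3 * (-k - 1) + r + 3 by ring, hX, thetaSeq_add_three h0] at ih
      exact mul_left_cancel₀ (zpow_ne_zero _ h0) ih
  have hn : n = 3 * (n / 3) + n % 3 := by omega
  rw [hn]
  apply key
  have : n % 3 = 0 ∨ n % 3 = 1 ∨ n % 3 = 2 := by omega
  rcases this with e | e | e <;> rw [e] <;> simp [thetaSeq]

theorem thetaSeq_linear (q : ℂ) (h : ℤ) (x y a b c a' b' c' : ℂ) (n : ℤ) :
    thetaSeq q h (x * a + y * a') (x * b + y * b') (x * c + y * c') n =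
      x * thetaSeq q h a b c n + y * thetaSeq q h a' b' c' n := by
  unfold thetaSeq
  split_ifs <;> ring

/-- The exponent of q is quadratic in n, so it dominates |n| up to a constant; 30 is merely large
enough. The two bounds serve the points u = q and u = 1. -/
theorem norm_thetaSeq_le {q : ℂ} (h0 : q ≠ 0) (h1 : ‖q‖ < 1) {h : ℤ} (hh : 6 ≤ h) (hh' : h ≤ 8)
    (a b c : ℂ) (n : ℤ) :
    ‖thetaSeq q h a b c n‖ * ‖q‖ ^ n ≤ (‖a‖ + ‖b‖ + ‖c‖) * ‖q‖ ^ (|n| - 30) ∧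
    ‖thetaSeq q h a b c n‖ ≤ (‖a‖ + ‖b‖ + ‖c‖) * ‖q‖ ^ (|n| - 30) := by
  have hr : 0 < ‖q‖ := norm_pos_iff.2 h0
  have hc : ‖if n % 3 = 0 then a else if n % 3 = 1 then b else c‖ ≤ ‖a‖ + ‖b‖ + ‖c‖ := by
    have := norm_nonneg a
    have := norm_nonneg b
    have := norm_nonneg c
    split_ifs <;> linarith
  have hn : n = 3 * (n / 3) + n % 3 := by omega
  have hr0 : 0 ≤ n % 3 := by omega
  have hr2 : n % 3 ≤ 2 := by omega
  unfold thetaSeq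
  generalize n / 3 = k at *
  generalize n % 3 = r at *
  have hk : 4 * |k| - 4 ≤ k ^ 2 := by
    nlinarith [sq_nonneg (|k| - 2), sq_abs k]
  have hk' : |n| ≤ 3 * |k| + 2 := by
    rcases abs_cases k with ⟨e, _⟩ | ⟨e, _⟩ <;> rcases abs_cases n with ⟨e', _⟩ | ⟨e', _⟩ <;> omega
  have main : ∀ j : ℤ, j = 0 ∨ j = n →
      |n| - 30 ≤ 6 * k ^ 2 + (h - 6) * k + 4 * r * k + j := by
    intro j hj
    have h3 : (h = 6 ∨ h = 7 ∨ h = 8) ∧ (r = 0 ∨ r = 1 ∨ r = 2) := by omega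
    rcases abs_cases k with ⟨e, _⟩ | ⟨e, _⟩ <;> rw [e] at hk hk' <;>
    rcases h3 with ⟨rfl | rfl | rfl, rfl | rfl | rfl⟩ <;> rcases hj with rfl | rfl <;> linarith
  rw [norm_mul, norm_zpow, mul_assoc, ← zpow_add₀ hr.ne']
  constructor
  · exact mul_le_mul hc (zpow_le_zpow_right_of_le_one₀ hr h1.le (main n (Or.inr rfl)))
      (by positivity) (by positivity)
  · refine mul_le_mul hc (zpow_le_zpow_right_of_le_one₀ hr h1.le ?_)
      (by positivity) (by positivity)
    simpa using main 0 (Or.inl rfl)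

theorem summable_norm_thetaSeq {q : ℂ} (h0 : q ≠ 0) (h1 : ‖q‖ < 1) {h : ℤ} (hh : 6 ≤ h)
    (hh' : h ≤ 8) (a b c : ℂ) : Summable fun n => ‖thetaSeq q h a b c n‖ :=
  Summable.of_nonneg_of_le (fun _ => norm_nonneg _)
    (fun n => (norm_thetaSeq_le h0 h1 hh hh' a b c n).2)
    ((summable_zpow_of_abs_le (norm_pos_iff.2 h0) h1 30 fun _ => le_rfl).mul_left _)

theorem summable_norm_thetaSeq_mul_zpow {q : ℂ} (h0 : q ≠ 0) (h1 : ‖q‖ < 1) {h : ℤ} (hh : 6 ≤ h)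
    (hh' : h ≤ 8) (a b c : ℂ) : Summable fun n => ‖thetaSeq q h a b c n * q ^ n‖ :=
  Summable.of_nonneg_of_le (fun _ => norm_nonneg _)
    (fun n => by
      rw [norm_mul, norm_zpow]; exact (norm_thetaSeq_le h0 h1 hh hh' a b c n).1)
    ((summable_zpow_of_abs_le (norm_pos_iff.2 h0) h1 30 fun _ => le_rfl).mul_left _)

/-- Regroups a double sum over (m, l) by n = d m + l: d = 1 gives the Cauchy product, d = 3 collects
powers of u in the Appell series. -/
theorem hasSum_tsum_fiber {w : ℤ × ℤ → ℂ} {S : ℂ} (hw : HasSum w S) (d : ℤ) :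
    HasSum (fun n => ∑' m, w (m, n - d * m)) S ∧
      ∀ n, Summable fun m => w (m, n - d * m) := by
  let e : ℤ × ℤ ≃ ℤ × ℤ :=
    { toFun := fun p => (p.2, p.1 - d * p.2)
      invFun := fun p => (p.2 + d * p.1, p.1)
      left_inv := fun p => by ext <;> simp
      right_inv := fun p => by ext <;> simp }
  have h : HasSum (w ∘ e) S := (Equiv.hasSum_iff e).2 hw
  have hs : ∀ n, Summable fun m => w (m, n - d * m) := fun n => h.summable.prod_factor n
  exact ⟨h.prod_fiberwise fun n => (hs n).hasSum, hs⟩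

/-! ### Theta function times Lambert kernel -/

/-- The convolution of `t` with `eps q`. -/
noncomputable def epsConv (q : ℂ) (t : ℤ → ℂ) (n : ℤ) : ℂ := ∑' j, t j * eps q (n - j)

theorem hasSum_epsConv {q : ℂ} (h0 : q ≠ 0) (h1 : ‖q‖ < 1) {t : ℤ → ℂ}
    (ht : Summable fun j => ‖t j * q ^ j‖) :
    HasSum (fun n => epsConv q t n * q ^ n) ((∑' j, t j * q ^ j) * ∑' l, eps q l * q ^ l) := by
  have hw : HasSum (fun p : ℤ × ℤ => (t p.1 * q ^ p.1) * (eps q p.2 * q ^ p.2))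
      ((∑' j, t j * q ^ j) * ∑' l, eps q l * q ^ l) := by
    have he := summable_norm_eps_mul_zpow h0 h1
    have := summable_mul_of_summable_norm ht he
    rw [tsum_mul_tsum_of_summable_norm ht he]
    exact this.hasSum
  convert (hasSum_tsum_fiber hw 1).1 using 2 with n
  unfold epsConv
  rw [← tsum_mul_right]
  refine tsum_congr fun j => ?_
  have : q ^ n = q ^ j * q ^ (n - 1 * j) := by rw [← zpow_add₀ h0]; congr 1; ring
  rw [this, one_mul]
  ring

/-- Shift j by 3 and write q^(4j+h) = q^(4n+h) q^(-4(n-j)). By `eps_mul_zpow` the second factor only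
adds a character term to the kernel, so the convolution obeys the recursion of t up to a term of
antiperiod 2. -/
theorem epsConv_add_three {q : ℂ} (h0 : q ≠ 0) (h1 : ‖q‖ < 1) {h : ℤ} {t : ℤ → ℂ}
    (ht : Summable fun j => ‖t j‖) (hrec : ∀ n, t (n + 3) = q ^ (4 * n + h) * t n) (n : ℤ) :
    epsConv q t (n + 3) = q ^ (4 * n + h) * epsConv q t n +
      ∑' j, t j * altSeq 0 1 (n + 3 - j) := by
  have hb : ∀ (f : ℤ → ℂ) (M : ℝ), (∀ l, ‖f l‖ ≤ M) → ∀ n, Summable fun j => t j * f (n - j) := by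
    intro f M hM n
    refine Summable.of_norm_bounded (ht.mul_right M) fun j => ?_
    rw [norm_mul]
    exact mul_le_mul_of_nonneg_left (hM _) (norm_nonneg _)
  have s1 := hb (eps q) _ (fun l => (norm_eps_le h0 h1 l).1) n
  have s2 := hb (altSeq 0 1) _ (norm_altSeq_le 0 1) (n + 3)
  have e2 := (Equiv.addRight (3 : ℤ)).tsum_eq fun j => t j * altSeq 0 1 (n + 3 - j)
  have s2' : Summable fun j => t (j + 3) * altSeq 0 1 (n - j) := by
    have := (Equiv.addRight (3 : ℤ)).summable_iff.2 s2
    refine this.congr fun j => ?_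
    simp
  unfold epsConv
  rw [← (Equiv.addRight (3 : ℤ)).tsum_eq fun j => t j * eps q (n + 3 - j), ← e2]
  simp only [Equiv.coe_addRight, add_sub_add_right_eq_sub]
  rw [← tsum_mul_left, ← (s1.mul_left _).tsum_add s2']
  refine tsum_congr fun j => ?_
  have h4 := eps_mul_zpow h0 h1 (n - j)
  have : q ^ (4 * j + h) = q ^ (4 * n + h) * q ^ (-4 * (n - j)) := by
    rw [← zpow_add₀ h0]; congr 1; ring
  rw [hrec, this]
  linear_combination q ^ (4 * n + h) * t j * h4

/-! ### Appell-type series of degree three -/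

/-- `1` if `m, l ≥ 0`, `-1` if `m, l < 0`, and `0` otherwise. -/
def quadrantSign (m l : ℤ) : ℂ :=
  if 0 ≤ m ∧ 0 ≤ l then 1 else if m < 0 ∧ l < 0 then -1 else 0

/-- The coefficients of the Appell-type series
`∑ m, q ^ (6 m ^ 2 + (h - 6) m) * u ^ (3 m) * (a + b x) / (1 + x ^ 2)` with `x = u * q ^ (4 m)`,
expanded in powers of `u` on `|q| ^ 4 < |u| < 1`. -/
noncomputable def appellCoeff (q : ℂ) (h : ℤ) (a b : ℂ) (n : ℤ) : ℂ :=
  ∑' m : ℤ, quadrantSign m (n - 3 * m) * altSeq a b (n - 3 * m) *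
    q ^ (6 * m ^ 2 + (h - 6) * m + 4 * m * (n - 3 * m))

/-- The Appell-type series whose expansion is given by `appellCoeff`, at `u = q`. -/
noncomputable def appellTerm (q : ℂ) (h : ℤ) (a b : ℂ) (m : ℤ) : ℂ :=
  q ^ (6 * m ^ 2 + (h - 6) * m + 3 * m) *
    ((a + b * q ^ (4 * m + 1)) / (1 + (q ^ (4 * m + 1)) ^ 2))

/-- The fraction is expanded in powers of x when m ≥ 0 and of x⁻¹ when m < 0; the second expansion
produces the minus sign of `quadrantSign`. -/
theorem hasSum_quadrant {x : ℂ} (h0 : x ≠ 0) (a b : ℂ) (m : ℤ)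
    (hx : 0 ≤ m → ‖x‖ < 1) (hx' : m < 0 → ‖x⁻¹‖ < 1) :
    HasSum (fun l : ℤ => quadrantSign m l * altSeq a b l * x ^ l) ((a + b * x) / (1 + x ^ 2)) := by
  rcases le_or_gt 0 m with hm | hm
  · have h1 : HasSum (fun l : ℕ => quadrantSign m l * altSeq a b l * x ^ (l : ℤ))
        ((a + b * x) / (1 + x ^ 2)) := by
      simpa [quadrantSign, hm] using hasSum_altSeq_nat a b (hx hm)
    have h2 : HasSum (fun l : ℕ => quadrantSign m (-(l + 1 : ℤ)) * altSeq a b (-(l + 1 : ℤ)) *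
        x ^ (-(l + 1 : ℤ))) 0 := by
      convert hasSum_zero with l
      have h3 : quadrantSign m (-((l : ℤ) + 1)) = 0 := by
        unfold quadrantSign
        rw [if_neg (by omega), if_neg (by omega)]
      rw [h3, zero_mul, zero_mul]
    simpa using HasSum.of_nat_of_neg_add_one
      (f := fun l : ℤ => quadrantSign m l * altSeq a b l * x ^ l) h1 h2
  · have h1 : HasSum (fun l : ℕ => quadrantSign m l * altSeq a b l * x ^ (l : ℤ)) 0 := by
      convert hasSum_zero with l
      have h3 : quadrantSign m l = 0 := by
        unfold quadrantSign
        rw [if_neg (by omega), if_neg (by omega)]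
      rw [h3, zero_mul, zero_mul]
    have hs : ∀ l : ℤ, altSeq a b (-(l + 1)) = altSeq (-b) (-a) l := by
      intro l
      rw [eq_altSeq (f := fun l => altSeq a b (-(l + 1))) _ l]
      · norm_num [altSeq]
      · intro l
        have := altSeq_add_two a b (-(l + 2 + 1))
        rw [show -(l + 2 + 1) + 2 = -(l + 1) by ring] at this
        rw [this, neg_neg]
    have h2 : HasSum (fun l : ℕ => quadrantSign m (-(l + 1 : ℤ)) * altSeq a b (-(l + 1 : ℤ)) *
        x ^ (-(l + 1 : ℤ))) ((a + b * x) / (1 + x ^ 2)) := by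
      have := (hasSum_altSeq_nat (-b) (-a) (hx' hm)).mul_left (-x⁻¹)
      have e : -x⁻¹ * ((-b + -a * x⁻¹) / (1 + x⁻¹ ^ 2)) = (a + b * x) / (1 + x ^ 2) := by
        rw [show 1 + x⁻¹ ^ 2 = (1 + x ^ 2) / x ^ 2 by field_simp; ring, div_div_eq_mul_div,
          ← mul_div_assoc]
        congr 1
        field_simp
        ring
      rw [e] at this
      refine this.congr_fun fun l => ?_
      have h3 : quadrantSign m (-((l : ℤ) + 1)) = -1 := by
        unfold quadrantSign
        rw [if_neg (by omega), if_pos (by omega)]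
      rw [hs, h3, zpow_neg, zpow_add₀ h0, zpow_natCast, zpow_one, inv_pow, mul_inv]
      ring
    simpa using HasSum.of_nat_of_neg_add_one
      (f := fun l : ℤ => quadrantSign m l * altSeq a b l * x ^ l) h1 h2

theorem summable_quadrant {q : ℂ} (h0 : q ≠ 0) (h1 : ‖q‖ < 1) {h : ℤ} (hh : 6 ≤ h) (hh' : h ≤ 8)
    (a b : ℂ) :
    Summable fun p : ℤ × ℤ => quadrantSign p.1 p.2 * altSeq a b p.2 *
      q ^ (6 * p.1 ^ 2 + (h - 6) * p.1 + 4 * p.1 * p.2 + 3 * p.1 + p.2) := by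
  have hr : 0 < ‖q‖ := norm_pos_iff.2 h0
  refine Summable.of_norm_bounded ((summable_zpow_prod_of_abs_le hr h1
    (f := fun p => 6 * p.1 ^ 2 + (h - 6) * p.1 + 4 * p.1 * p.2 + 3 * p.1 + p.2) 0
    {p | (0 ≤ p.1 ∧ 0 ≤ p.2) ∨ (p.1 < 0 ∧ p.2 < 0)} ?_).mul_left (‖a‖ + ‖b‖)) ?_
  · rintro ⟨m, l⟩ (⟨hm, hl⟩ | ⟨hm, hl⟩)
    · simp only at *
      rw [abs_of_nonneg hm, abs_of_nonneg hl]
      nlinarith [mul_nonneg hm hl, mul_nonneg (sub_nonneg.2 hh) hm]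
    · simp only at *
      rw [abs_of_neg hm, abs_of_neg hl]
      nlinarith [mul_nonneg (show 0 ≤ -1 - m by omega) (show 0 ≤ -1 - l by omega),
        mul_nonneg (show 0 ≤ -1 - m by omega) (sub_nonneg.2 hh')]
  · rintro ⟨m, l⟩
    rw [norm_mul, norm_mul, norm_zpow]
    by_cases hp : (0 ≤ m ∧ 0 ≤ l) ∨ (m < 0 ∧ l < 0)
    · rw [Set.indicator_of_mem (by exact hp)]
      refine mul_le_mul_of_nonneg_right ?_ (zpow_pos hr _).le
      have : ‖quadrantSign m l‖ ≤ 1 := by unfold quadrantSign; split_ifs <;> simp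
      exact (mul_le_of_le_one_left (norm_nonneg _) this).trans (norm_altSeq_le a b l)
    · rw [Set.indicator_of_notMem (by exact hp)]
      have : quadrantSign m l = 0 := by
        unfold quadrantSign
        rw [if_neg (fun h => hp (Or.inl h)), if_neg (fun h => hp (Or.inr h))]
      simp [this]

theorem norm_inv_zpow_lt {q : ℂ} (h0 : q ≠ 0) (h1 : ‖q‖ < 1) {m : ℤ} (hm : m < 0) :
    ‖(q ^ m)⁻¹‖ < 1 := by
  rw [← zpow_neg, norm_zpow]
  exact zpow_lt_one₀ (norm_pos_iff.2 h0) h1 (by omega)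

theorem hasSum_appellTerm {q : ℂ} (h0 : q ≠ 0) (h1 : ‖q‖ < 1) {h : ℤ} (hh : 6 ≤ h) (hh' : h ≤ 8)
    (a b : ℂ) :
    Summable (appellTerm q h a b) ∧
    HasSum (fun n => appellCoeff q h a b n * q ^ n) (∑' m, appellTerm q h a b m) ∧
    ∀ n, Summable fun m : ℤ => quadrantSign m (n - 3 * m) * altSeq a b (n - 3 * m) *
      q ^ (6 * m ^ 2 + (h - 6) * m + 4 * m * (n - 3 * m)) := by
  have hr : 0 < ‖q‖ := norm_pos_iff.2 h0
  have hw := (summable_quadrant h0 h1 hh hh' a b).hasSum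
  have hf := hw.prod_fiberwise (g := appellTerm q h a b) fun m => by
    have := (hasSum_quadrant (zpow_ne_zero (4 * m + 1) h0) a b m (fun hm => by
      rw [norm_zpow]; exact zpow_lt_one₀ hr h1 (by omega)) (fun hm =>
        norm_inv_zpow_lt h0 h1 (by omega))).mul_left (q ^ (6 * m ^ 2 + (h - 6) * m + 3 * m))
    refine this.congr_fun fun l => ?_
    rw [← zpow_mul, mul_left_comm, ← zpow_add₀ h0]
    congr 2
    ring
  have hq := hasSum_tsum_fiber hw 3
  rw [← hf.tsum_eq] at hq
  have e : ∀ n m : ℤ, quadrantSign m (n - 3 * m) * altSeq a b (n - 3 * m) *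
      q ^ (6 * m ^ 2 + (h - 6) * m + 4 * m * (n - 3 * m) + 3 * m + (n - 3 * m)) =
      quadrantSign m (n - 3 * m) * altSeq a b (n - 3 * m) *
      q ^ (6 * m ^ 2 + (h - 6) * m + 4 * m * (n - 3 * m)) * q ^ n := by
    intro n m
    rw [mul_assoc _ _ (q ^ n), ← zpow_add₀ h0]
    congr 2
    ring
  simp only [e] at hq
  refine ⟨hf.summable, ?_, fun n => ?_⟩
  · simpa only [appellCoeff, tsum_mul_right] using hq.1
  · exact (summable_mul_right_iff (zpow_ne_zero n h0)).1 (hq.2 n)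

/-- Replacing m by m + 1 keeps n - 3m when n becomes n + 3 and raises the exponent by 4n + h. The
signs differ only in passing from m = -1 to m = 0, and that single term is the inhomogeneity. -/
theorem appellCoeff_add_three {q : ℂ} (h0 : q ≠ 0) (h1 : ‖q‖ < 1) {h : ℤ} (hh : 6 ≤ h)
    (hh' : h ≤ 8) (a b : ℂ) (n : ℤ) :
    appellCoeff q h a b (n + 3) = q ^ (4 * n + h) * appellCoeff q h a b n + altSeq a b (n + 3) := by
  have hs := (hasSum_appellTerm h0 h1 hh hh' a b).2.2
  unfold appellCoeff
  rw [← (Equiv.addRight (1 : ℤ)).tsum_eq, ← sub_eq_iff_eq_add', ← tsum_mul_left,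
    ← Summable.tsum_sub (f := fun c => quadrantSign (Equiv.addRight 1 c) _ * _ * _)
      ((Equiv.addRight (1 : ℤ)).summable_iff.2 (hs (n + 3))) ((hs n).mul_left _)]
  rw [tsum_eq_single (-1)]
  · simp only [Equiv.coe_addRight]
    have hd : ∀ l : ℤ, quadrantSign (-1 + 1) l - quadrantSign (-1) l = 1 := by
      intro l
      rcases le_or_gt 0 l with hl | hl
      · have : ¬ l < 0 := by omega
        norm_num [quadrantSign, hl, this]
      · have : ¬ 0 ≤ l := by omega
        norm_num [quadrantSign, hl, this]
    have hd' := hd (n + 3)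
    rw [show n + 3 - 3 * (-1 + 1) = n + 3 by ring, show n - 3 * -1 = n + 3 by ring]
    rw [show (6 * (-1 + 1) ^ 2 + (h - 6) * (-1 + 1) + 4 * (-1 + 1) * (n + 3) : ℤ) = 0 by ring]
    rw [mul_left_comm (q ^ (4 * n + h)), ← zpow_add₀ h0, show 4 * n + h +
      (6 * (-1) ^ 2 + (h - 6) * -1 + 4 * -1 * (n + 3)) = 0 by ring, zpow_zero]
    linear_combination altSeq a b (n + 3) * hd'
  · intro m hm
    have hs : quadrantSign (m + 1) (n - 3 * m) = quadrantSign m (n - 3 * m) := by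
      have e1 : (0 ≤ m + 1) ↔ 0 ≤ m := by omega
      have e2 : (m + 1 < 0) ↔ m < 0 := by omega
      simp only [quadrantSign, e1, e2]
    simp only [Equiv.coe_addRight]
    rw [show n + 3 - 3 * (m + 1) = n - 3 * m by ring, hs, mul_left_comm (q ^ (4 * n + h)),
      ← zpow_add₀ h0, sub_eq_zero]
    congr 2
    ring

theorem appellCoeff_init (q : ℂ) (h : ℤ) (a b : ℂ) {n : ℤ} (hn : 0 ≤ n) (hn' : n < 3) :
    appellCoeff q h a b n = altSeq a b n := by
  unfold appellCoeff
  rw [tsum_eq_single 0]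
  · simp [quadrantSign, hn]
  · intro m hm
    have : quadrantSign m (n - 3 * m) = 0 := by
      unfold quadrantSign
      rw [if_neg (by omega), if_neg (by omega)]
    simp [this]

/-! ### Reflection, and cancellation of the Appell series -/

/-- The convolution of `t` with the odd character modulo `4`. -/
noncomputable def charConv (t : ℤ → ℂ) (n : ℤ) : ℂ := ∑' j, t j * altSeq 0 1 (n - j)

theorem charConv_add_two (t : ℤ → ℂ) (n : ℤ) : charConv t (n + 2) = -charConv t n := by
  unfold charConv
  rw [← tsum_neg]
  refine tsum_congr fun j => ?_
  rw [show n + 2 - j = n - j + 2 by ring, altSeq_add_two]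
  ring

theorem charConv_reflect {t : ℤ → ℂ} {c : ℤ} (ht : ∀ j, t (c - j) = -t j) (n : ℤ) :
    charConv t n = charConv t (c - n) := by
  unfold charConv
  rw [← (Equiv.subLeft c).tsum_eq]
  refine tsum_congr fun j => ?_
  rw [Equiv.subLeft_apply, ht, show n - (c - j) = -(c - n - j) by ring, altSeq_zero_one_neg]
  ring

/-- The kernel is odd up to a character term (`eps_neg`) and t is odd about its centre, so
reflection relates the convolution to itself. This fixes or links some of the initial values needed
later. -/
theorem epsConv_reflect {q : ℂ} (h0 : q ≠ 0) (h1 : ‖q‖ < 1) {t : ℤ → ℂ}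
    (hs : Summable fun j => ‖t j‖) {c : ℤ} (ht : ∀ j, t (c - j) = -t j) (n : ℤ) :
    epsConv q t n = charConv t (c - n) - epsConv q t (c - n) := by
  have hb : ∀ (f : ℤ → ℂ) (M : ℝ), (∀ l, ‖f l‖ ≤ M) → ∀ n, Summable fun j => t j * f (n - j) := by
    intro f M hM n
    refine Summable.of_norm_bounded (hs.mul_right M) fun j => ?_
    rw [norm_mul]
    exact mul_le_mul_of_nonneg_left (hM _) (norm_nonneg _)
  have s1 := hb (eps q) _ (fun l => (norm_eps_le h0 h1 l).1) (c - n)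
  have s2 := hb (altSeq 0 1) _ (norm_altSeq_le 0 1) (c - n)
  unfold charConv epsConv
  rw [← s2.tsum_sub s1, ← (Equiv.subLeft c).tsum_eq]
  refine tsum_congr fun j => ?_
  rw [Equiv.subLeft_apply, ht, show n - (c - j) = -(c - n - j) by ring, eps_neg h0 h1]
  ring

/-- The convolution and κ times the Appell coefficients satisfy the same inhomogeneous recursion, so
their difference is a theta sequence, determined at n = 0, 1, 2. The third entry carries +κa because
`altSeq a b 2` is -a. -/
theorem epsConv_mul_sub_appell {q : ℂ} (h0 : q ≠ 0) (h1 : ‖q‖ < 1) {h : ℤ} (hh : 6 ≤ h)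
    (hh' : h ≤ 8) {t : ℤ → ℂ} (hs : Summable fun j => ‖t j‖)
    (hs' : Summable fun j => ‖t j * q ^ j‖)
    (hrec : ∀ n, t (n + 3) = q ^ (4 * n + h) * t n) {a b κ : ℂ}
    (hκ : ∀ n, charConv t n = κ * altSeq a b n) :
    (∑' j, t j * q ^ j) * (∑' l, eps q l * q ^ l) - κ * ∑' m, appellTerm q h a b m =
      ∑' n, thetaSeq q h (epsConv q t 0 - κ * a) (epsConv q t 1 - κ * b)
        (epsConv q t 2 + κ * a) n * q ^ n := by
  have hX : ∀ n, (fun n => epsConv q t n - κ * appellCoeff q h a b n) (n + 3) =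
      q ^ (4 * n + h) * (fun n => epsConv q t n - κ * appellCoeff q h a b n) n := by
    intro n
    have := hκ (n + 3)
    unfold charConv at this
    simp only
    rw [epsConv_add_three h0 h1 hs hrec, appellCoeff_add_three h0 h1 hh hh', this]
    ring
  have h2 := (hasSum_epsConv h0 h1 hs').sub ((hasSum_appellTerm h0 h1 hh hh' a b).2.1.mul_left κ)
  rw [← h2.tsum_eq]
  refine tsum_congr fun n => ?_
  have := eq_thetaSeq (X := fun n => epsConv q t n - κ * appellCoeff q h a b n) h0 hX n
  simp only [appellCoeff_init q h a b (n := 0) (by norm_num) (by norm_num),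
    appellCoeff_init q h a b (n := 1) (by norm_num) (by norm_num),
    appellCoeff_init q h a b (n := 2) (by norm_num) (by norm_num)] at this
  rw [← mul_assoc, ← sub_mul, this]
  norm_num [altSeq]

/-! ### Rearranging bilateral series; the pentagonal and Lambert series -/

theorem tsum_eq_tsum_mod_three {F : ℤ → ℂ} (hF : Summable F) :
    ∑' n, F n = ∑' k : ℤ, (F (3 * k) + F (3 * k + 1) + F (3 * k + 2)) := by
  have hs' : Summable fun p => F ((Int.divModEquiv 3).symm p) :=
    (Int.divModEquiv 3).symm.summable_iff.2 hF
  rw [← (Int.divModEquiv 3).symm.tsum_eq, hs'.tsum_prod]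
  refine tsum_congr fun k => ?_
  have e : ∀ i : Fin 3, ((Int.divModEquiv 3).symm (k, i) : ℤ) = 3 * k + (i : ℕ) := by
    intro i
    simp [Int.divModEquiv]
    ring
  rw [tsum_fintype, Fin.sum_univ_three, e, e, e]
  simp

theorem tsum_thetaSeq_mul_zpow {q : ℂ} (h0 : q ≠ 0) (h1 : ‖q‖ < 1) {h : ℤ} (hh : 6 ≤ h)
    (hh' : h ≤ 8) (a b c : ℂ) :
    ∑' n, thetaSeq q h a b c n * q ^ n = ∑' k : ℤ, (a * q ^ (6 * k ^ 2 + (h - 6) * k + 3 * k) +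
      b * q ^ (6 * k ^ 2 + (h - 6) * k + 4 * k + 3 * k + 1) +
      c * q ^ (6 * k ^ 2 + (h - 6) * k + 8 * k + 3 * k + 2)) := by
  rw [tsum_eq_tsum_mod_three (summable_norm_thetaSeq_mul_zpow h0 h1 hh hh' a b c).of_norm]
  refine tsum_congr fun k => ?_
  have a1 : 3 * k / 3 = k := by omega
  have a2 : 3 * k % 3 = 0 := by omega
  have b1 : (3 * k + 1) / 3 = k := by omega
  have b2 : (3 * k + 1) % 3 = 1 := by omega
  have c1 : (3 * k + 2) / 3 = k := by omega
  have c2 : (3 * k + 2) % 3 = 2 := by omega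
  unfold thetaSeq
  rw [a1, a2, b1, b2, c1, c2, if_pos rfl, if_neg (by norm_num), if_pos rfl, if_neg (by norm_num),
    if_neg (by norm_num), mul_assoc a (q ^ _), mul_assoc b (q ^ _), mul_assoc c (q ^ _),
    ← zpow_add₀ h0,
    ← zpow_add₀ h0,
    ← zpow_add₀ h0]
  ring_nf

/-- Folds ℤ onto ℕ: j ≥ 0 sits at 2j and -1 - j at 2j + 1, which accounts for the sign (-1)^k of the
one-sided series. -/
theorem hasSum_nat_of_fold {F : ℤ → ℂ} {g : ℕ → ℂ} (hF : Summable F)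
    (he : ∀ j : ℕ, g (2 * j) = F j) (ho : ∀ j : ℕ, g (2 * j + 1) = F (-1 - j)) :
    HasSum g (∑' k, F k) := by
  have h1 : Summable fun j : ℕ => F j := hF.comp_injective Nat.cast_injective
  have h2 : Summable fun j : ℕ => F (-1 - j) :=
    hF.comp_injective (i := fun j : ℕ => -1 - (j : ℤ)) fun a b hab => by simpa using hab
  have h2' : Summable fun j : ℕ => F (-(j + 1 : ℤ)) := h2.congr fun j => by congr 1; ring
  rw [tsum_of_nat_of_neg_add_one h1 h2']
  refine HasSum.even_add_odd ?_ ?_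
  · simpa only [he] using h1.hasSum
  · have : (fun k : ℕ => g (2 * k + 1)) = fun j : ℕ => F (-(j + 1 : ℤ)) := by
      funext j
      rw [ho]; congr 1; ring
    rw [this]
    exact h2'.hasSum

theorem triangle_even (j : ℕ) : 2 * j * (2 * j + 1) / 2 = j * (2 * j + 1) := by
  rw [mul_assoc, Nat.mul_div_cancel_left _ two_pos]

theorem triangle_odd (j : ℕ) : (2 * j + 1) * (2 * j + 1 + 1) / 2 = (2 * j + 1) * (j + 1) := by
  rw [show (2 * j + 1) * (2 * j + 1 + 1) = 2 * ((2 * j + 1) * (j + 1)) by ring,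
    Nat.mul_div_cancel_left _ two_pos]

/-- The alternating series of pentagonal powers of `q`. -/
noncomputable def pentSum (q : ℂ) : ℂ :=
  ∑' k : ℕ, (-1) ^ k * q ^ (3 * (k * (k + 1) / 2)) * (1 - q ^ (2 * k + 1)) * (q ^ k)⁻¹

/-- The Lambert-type series of the even part. -/
noncomputable def evenLambert (q : ℂ) : ℂ :=
  ∑' k : ℕ, (-1) ^ k * q ^ (3 * (k * (k + 1) / 2)) * (1 - q ^ (2 * k + 1)) *
    ((1 + q ^ (2 * k + 1)) / (1 + q ^ (4 * k + 2)))

/-- The Lambert-type series of the odd part. -/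
noncomputable def oddLambert (q : ℂ) : ℂ :=
  ∑' k : ℕ, (-1) ^ k * q ^ (3 * (k * (k + 1) / 2)) * (1 - q ^ (2 * k + 1)) *
    (q ^ k / (1 + q ^ (4 * k + 2)))

theorem summable_zpow_quadratic {q : ℂ} (h0 : q ≠ 0) (h1 : ‖q‖ < 1) (b c : ℤ) :
    Summable fun k : ℤ => q ^ (6 * k ^ 2 + b * k + c) := by
  refine Summable.of_norm ?_
  simp only [norm_zpow]
  refine summable_zpow_of_abs_le (norm_pos_iff.2 h0) h1 ((|b| + 1) ^ 2 - c) fun k => ?_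
  have h2 : -(|b| * |k|) ≤ b * k := by rw [← abs_mul]; exact neg_abs_le _
  nlinarith [sq_nonneg (|k| - (|b| + 1)), sq_abs k, abs_nonneg b, abs_nonneg k]

theorem tsum_pentagonal_eq {q : ℂ} (h0 : q ≠ 0) (h1 : ‖q‖ < 1) :
    ∑' k : ℤ, (q ^ (6 * k ^ 2 + 5 * k + 0) - q ^ (6 * k ^ 2 + 1 * k + -1)) =
      -(q⁻¹ * pentSum q) := by
  have hs := ((summable_zpow_quadratic h0 h1 5 0).sub
    (summable_zpow_quadratic h0 h1 1 (-1))).mul_left (-q)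
  have := hasSum_nat_of_fold (g := fun k : ℕ => (-1) ^ k * q ^ (3 * (k * (k + 1) / 2)) *
    (1 - q ^ (2 * k + 1)) * (q ^ k)⁻¹) hs ?_ ?_
  · unfold pentSum
    rw [this.tsum_eq, tsum_mul_left]
    field_simp
  · intro j
    rw [triangle_even, Even.neg_one_pow (even_two_mul j)]
    simp only [← zpow_natCast, ← zpow_neg]
    rw [one_mul, mul_sub, sub_mul, mul_sub, mul_one, ← zpow_add₀ h0, ← zpow_add₀ h0,
      ← zpow_add₀ h0]
    simp only [neg_mul, ← zpow_one_add₀ h0]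
    push_cast
    ring_nf
  · intro j
    rw [triangle_odd, Odd.neg_one_pow (odd_two_mul_add_one j)]
    simp only [← zpow_natCast, ← zpow_neg]
    rw [mul_sub, sub_mul, mul_sub, mul_one, neg_one_mul, neg_mul, neg_mul, neg_mul,
      ← zpow_add₀ h0, ← zpow_add₀ h0, ← zpow_add₀ h0, neg_mul, neg_mul,
      ← zpow_one_add₀ h0, ← zpow_one_add₀ h0]
    push_cast
    ring_nf

theorem one_add_pow_ne_zero {q : ℂ} (h1 : ‖q‖ < 1) {n : ℕ} (hn : n ≠ 0) : 1 + q ^ n ≠ 0 := by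
  intro h
  have h2 : ‖q‖ ^ n = 1 := by
    rw [← norm_pow, ← neg_eq_of_add_eq_zero_right h, norm_neg, norm_one]
  exact absurd h2 (pow_lt_one₀ (norm_nonneg _) h1 hn).ne

/-- With Z = q^(2k+1), (1 - Z)(1 + Z)/(1 + Z^2) = 2/(1 + Z^2) - 1; the -1 contributes the theta
series, the rest is the Appell series with numerator 2. -/
theorem evenLambert_eq {q : ℂ} (h0 : q ≠ 0) (h1 : ‖q‖ < 1) :
    evenLambert q = ∑' m, appellTerm q 6 2 0 m - ∑' k : ℤ, q ^ (6 * k ^ 2 + 3 * k + 0) := by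
  have s1 := (hasSum_appellTerm h0 h1 (le_refl 6) (by norm_num) 2 0).1
  have s2 := summable_zpow_quadratic h0 h1 3 0
  rw [← s1.tsum_sub s2]
  refine (hasSum_nat_of_fold (s1.sub s2) ?_ ?_).tsum_eq
  · intro j
    have hZ : 1 + (q ^ (4 * j + 1)) ^ 2 ≠ 0 := by
      rw [← pow_mul]; exact one_add_pow_ne_zero h1 (by omega)
    have e1 : q ^ (4 * (j : ℤ) + 1) = q ^ (4 * j + 1) := by rw [← zpow_natCast]; push_cast; rfl
    have e2 : q ^ (6 * (j : ℤ) ^ 2 + (6 - 6) * j + 3 * j) = q ^ (3 * (j * (2 * j + 1))) := by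
      rw [← zpow_natCast]; push_cast; ring_nf
    have e3 : q ^ (6 * (j : ℤ) ^ 2 + 3 * j + 0) = q ^ (3 * (j * (2 * j + 1))) := by
      rw [← zpow_natCast]; push_cast; ring_nf
    rw [triangle_even, Even.neg_one_pow (even_two_mul j), appellTerm, e1, e2, e3,
      show 2 * (2 * j) + 1 = 4 * j + 1 by ring, show 4 * (2 * j) + 2 = (4 * j + 1) * 2 by ring,
      pow_mul q (4 * j + 1) 2]
    generalize q ^ (4 * j + 1) = Z at *
    field_simp
    ring
  · intro j
    have hZ : 1 + (q ^ (4 * j + 3)) ^ 2 ≠ 0 := by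
      rw [← pow_mul]; exact one_add_pow_ne_zero h1 (by omega)
    have hZ0 : q ^ (4 * j + 3) ≠ 0 := pow_ne_zero _ h0
    have e1 : q ^ (4 * (-1 - (j : ℤ)) + 1) = (q ^ (4 * j + 3))⁻¹ := by
      rw [← zpow_natCast, ← zpow_neg]; push_cast; ring_nf
    have e2 : q ^ (6 * (-1 - (j : ℤ)) ^ 2 + (6 - 6) * (-1 - (j : ℤ)) + 3 * (-1 - (j : ℤ))) =
        q ^ (3 * ((2 * j + 1) * (j + 1))) := by
      rw [← zpow_natCast]; push_cast; ring_nf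
    have e3 : q ^ (6 * (-1 - (j : ℤ)) ^ 2 + 3 * (-1 - (j : ℤ)) + 0) =
        q ^ (3 * ((2 * j + 1) * (j + 1))) := by
      rw [← zpow_natCast]; push_cast; ring_nf
    rw [triangle_odd, Odd.neg_one_pow (odd_two_mul_add_one j), appellTerm, e1, e2, e3,
      show 2 * (2 * j + 1) + 1 = 4 * j + 3 by ring,
      show 4 * (2 * j + 1) + 2 = (4 * j + 3) * 2 by ring, pow_mul q (4 * j + 3) 2]
    generalize q ^ (4 * j + 3) = Z at *
    rw [show 1 + Z⁻¹ ^ 2 = (1 + Z ^ 2) / Z ^ 2 by field_simp; ring]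
    field_simp
    ring

theorem oddLambert_eq {q : ℂ} (h0 : q ≠ 0) (h1 : ‖q‖ < 1) :
    oddLambert q = ∑' m, appellTerm q 8 1 (-1) m := by
  have s1 := (hasSum_appellTerm h0 h1 (h := 8) (by norm_num) (le_refl 8) 1 (-1)).1
  refine (hasSum_nat_of_fold s1 ?_ ?_).tsum_eq
  · intro j
    have hZ : 1 + (q ^ (4 * j + 1)) ^ 2 ≠ 0 := by
      rw [← pow_mul]; exact one_add_pow_ne_zero h1 (by omega)
    have e1 : q ^ (4 * (j : ℤ) + 1) = q ^ (4 * j + 1) := by rw [← zpow_natCast]; push_cast; rfl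
    have e2 : q ^ (6 * (j : ℤ) ^ 2 + (8 - 6) * j + 3 * j) =
        q ^ (3 * (j * (2 * j + 1))) * q ^ (2 * j) := by
      rw [← pow_add, ← zpow_natCast]; push_cast; ring_nf
    rw [triangle_even, Even.neg_one_pow (even_two_mul j), appellTerm, e1, e2,
      show 2 * (2 * j) + 1 = 4 * j + 1 by ring, show 4 * (2 * j) + 2 = (4 * j + 1) * 2 by ring,
      pow_mul q (4 * j + 1) 2]
    generalize q ^ (4 * j + 1) = Z at *
    field_simp
    ring
  · intro j
    have hZ : 1 + (q ^ (4 * j + 3)) ^ 2 ≠ 0 := by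
      rw [← pow_mul]; exact one_add_pow_ne_zero h1 (by omega)
    have hZ0 : q ^ (4 * j + 3) ≠ 0 := pow_ne_zero _ h0
    have e1 : q ^ (4 * (-1 - (j : ℤ)) + 1) = (q ^ (4 * j + 3))⁻¹ := by
      rw [← zpow_natCast, ← zpow_neg]; push_cast; ring_nf
    have e2 : q ^ (6 * (-1 - (j : ℤ)) ^ 2 + (8 - 6) * (-1 - (j : ℤ)) + 3 * (-1 - (j : ℤ))) =
        q ^ (3 * ((2 * j + 1) * (j + 1))) * q ^ (2 * j + 1) * (q ^ (4 * j + 3))⁻¹ := by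
      rw [← pow_add, ← zpow_natCast, ← zpow_natCast, ← zpow_neg, ← zpow_add₀ h0]
      push_cast
      ring_nf
    rw [triangle_odd, Odd.neg_one_pow (odd_two_mul_add_one j), appellTerm, e1, e2,
      show 2 * (2 * j + 1) + 1 = 4 * j + 3 by ring,
      show 4 * (2 * j + 1) + 2 = (4 * j + 3) * 2 by ring, pow_mul q (4 * j + 3) 2]
    generalize q ^ (4 * j + 3) = Z at *
    rw [show 1 + Z⁻¹ ^ 2 = (1 + Z ^ 2) / Z ^ 2 by field_simp; ring]
    field_simp
    ring

/-! ### Odd theta sequences and closed forms for the Lambert series -/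

/-- The theta coefficients used for the even part. -/
noncomputable def evenTheta (q : ℂ) (n : ℤ) : ℂ := thetaSeq q 6 0 1 (-q ^ 2) n

/-- The theta coefficients used for the odd part. -/
noncomputable def oddTheta (q : ℂ) (n : ℤ) : ℂ := thetaSeq q 8 1 0 (-q ^ 4) n

theorem thetaSeq_neg_one (q : ℂ) (h : ℤ) (a b c : ℂ) :
    thetaSeq q h a b c (-1) = c * q ^ (4 - h) := by
  norm_num [thetaSeq]
  left
  ring_nf

theorem thetaSeq_neg_two (q : ℂ) (h : ℤ) (a b c : ℂ) :
    thetaSeq q h a b c (-2) = b * q ^ (8 - h) := by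
  norm_num [thetaSeq]
  left
  ring_nf

theorem thetaSeq_neg_three (q : ℂ) (h : ℤ) (a b c : ℂ) :
    thetaSeq q h a b c (-3) = a * q ^ (12 - h) := by
  norm_num [thetaSeq]
  left
  ring_nf

/-- The condition `h + 2 * c = 6` makes the negated reflection satisfy the same recursion, so
agreement at three points suffices. -/
theorem thetaSeq_reflect {q : ℂ} (h0 : q ≠ 0) {h c : ℤ} (hc : h + 2 * c = 6) {x y z : ℂ}
    (hx : thetaSeq q h x y z c = -x) (hy : thetaSeq q h x y z (c - 1) = -y)
    (hz : thetaSeq q h x y z (c - 2) = -z) (j : ℤ) :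
    thetaSeq q h x y z (c - j) = -thetaSeq q h x y z j := by
  have := eq_thetaSeq (h := h) (X := fun j => -thetaSeq q h x y z (c - j)) h0 (fun n => by
    have e := thetaSeq_add_three h0 h x y z (c - (n + 3))
    rw [show c - (n + 3) + 3 = c - n by ring] at e
    rw [e, mul_neg, ← mul_assoc, ← zpow_add₀ h0,
      show 4 * n + h + (4 * (c - (n + 3)) + h) = 0 by linarith, zpow_zero, one_mul]) j
  simp only [sub_zero, hx, hy, hz, neg_neg] at this
  rw [← this, neg_neg]

theorem evenTheta_reflect {q : ℂ} (h0 : q ≠ 0) (j : ℤ) : evenTheta q (0 - j) = -evenTheta q j := by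
  refine thetaSeq_reflect h0 (by norm_num) ?_ ?_ ?_ j
  · simp [thetaSeq]
  · rw [zero_sub, thetaSeq_neg_one, neg_mul, show (4 - 6 : ℤ) = -((2 : ℕ) : ℤ) by norm_num,
      zpow_neg,
      zpow_natCast, mul_inv_cancel₀ (pow_ne_zero _ h0)]
  · rw [zero_sub, thetaSeq_neg_two, show (8 - 6 : ℤ) = ((2 : ℕ) : ℤ) by norm_num, zpow_natCast,
      one_mul, neg_neg]

theorem oddTheta_reflect {q : ℂ} (h0 : q ≠ 0) (j : ℤ) : oddTheta q (-1 - j) = -oddTheta q j := by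
  refine thetaSeq_reflect h0 (by norm_num) ?_ ?_ ?_ j
  · rw [thetaSeq_neg_one, neg_mul, show (4 - 8 : ℤ) = -((4 : ℕ) : ℤ) by norm_num, zpow_neg,
      zpow_natCast, mul_inv_cancel₀ (pow_ne_zero _ h0)]
  · rw [show (-1 - 1 : ℤ) = -2 by norm_num, thetaSeq_neg_two]
    simp
  · rw [show (-1 - 2 : ℤ) = -3 by norm_num, thetaSeq_neg_three,
      show (12 - 8 : ℤ) = ((4 : ℕ) : ℤ) by norm_num,
      zpow_natCast, one_mul, neg_neg]

theorem tsum_evenTheta {q : ℂ} (h0 : q ≠ 0) (h1 : ‖q‖ < 1) :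
    ∑' n, evenTheta q n * q ^ n = -(q⁻¹ * pentSum q) := by
  rw [← tsum_pentagonal_eq h0 h1]
  unfold evenTheta
  rw [tsum_thetaSeq_mul_zpow h0 h1 le_rfl (by norm_num), ← (Equiv.subLeft (-1 : ℤ)).tsum_eq]
  refine tsum_congr fun k => ?_
  rw [Equiv.subLeft_apply, zero_mul, zero_add, one_mul, neg_mul, ← zpow_natCast q 2,
    ← zpow_add₀ h0, ← sub_eq_add_neg]
  push_cast
  congr 2 <;> ring

theorem tsum_oddTheta {q : ℂ} (h0 : q ≠ 0) (h1 : ‖q‖ < 1) :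
    ∑' n, oddTheta q n * q ^ n = -(q⁻¹ * pentSum q) := by
  rw [← tsum_pentagonal_eq h0 h1]
  unfold oddTheta
  have s1 := summable_zpow_quadratic h0 h1 5 0
  have s2 := summable_zpow_quadratic h0 h1 1 (-1)
  have s3 := summable_zpow_quadratic h0 h1 13 6
  have e : ∑' k : ℤ, q ^ (6 * k ^ 2 + 1 * k + -1) = ∑' k : ℤ, q ^ (6 * k ^ 2 + 13 * k + 6) := by
    rw [← (Equiv.addRight (1 : ℤ)).tsum_eq]
    refine tsum_congr fun k => ?_
    rw [Equiv.coe_addRight]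
    congr 1
    ring
  rw [s1.tsum_sub s2, e, ← s1.tsum_sub s3, tsum_thetaSeq_mul_zpow h0 h1 (by norm_num) le_rfl]
  refine tsum_congr fun k => ?_
  rw [zero_mul, add_zero, one_mul, neg_mul,
    ← zpow_natCast q 4, ← zpow_add₀ h0, ← sub_eq_add_neg]
  push_cast
  congr 2 <;> ring

/-- The Lambert series `∑ l, eps q l * q ^ l`. -/
noncomputable def epsSum (q : ℂ) : ℂ := ∑' l, eps q l * q ^ l

/-- Apply `epsConv_mul_sub_appell` to `evenTheta`. The remainder is a multiple of `evenTheta` plus a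
multiple of the theta series already subtracted in `evenLambert_eq`, and the two copies of that
series cancel. -/
theorem charConv_mul_evenLambert {q : ℂ} (h0 : q ≠ 0) (h1 : ‖q‖ < 1) :
    charConv (evenTheta q) 0 * evenLambert q =
      -(2 * (q⁻¹ * pentSum q) * (epsSum q - epsConv q (evenTheta q) 1)) := by
  have hs : Summable fun j => ‖evenTheta q j‖ :=
    summable_norm_thetaSeq h0 h1 le_rfl (by norm_num) _ _ _
  have hs' : Summable fun j => ‖evenTheta q j * q ^ j‖ :=
    summable_norm_thetaSeq_mul_zpow h0 h1 le_rfl (by norm_num) _ _ _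
  have hrec : ∀ n, evenTheta q (n + 3) = q ^ (4 * n + 6) * evenTheta q n :=
    thetaSeq_add_three h0 _ _ _ _
  have hr := evenTheta_reflect h0
  -- Reflection says the values at 1 and -1 agree, antiperiodicity that they are opposite.
  have c1 : charConv (evenTheta q) 1 = 0 := by
    have e1 := charConv_reflect hr 1
    have e2 := charConv_add_two (evenTheta q) (-1)
    norm_num at e1 e2
    rw [← e1] at e2
    linear_combination e2 / 2
  have hκ : ∀ n, charConv (evenTheta q) n = charConv (evenTheta q) 0 / 2 * altSeq 2 0 n := by
    intro n
    rw [eq_altSeq (charConv_add_two (evenTheta q)) n, c1]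
    unfold altSeq
    split_ifs <;> ring
  have y0 : epsConv q (evenTheta q) 0 = charConv (evenTheta q) 0 / 2 := by
    have := epsConv_reflect h0 h1 hs hr 0
    norm_num at this
    linear_combination this / 2
  have y2 : epsConv q (evenTheta q) 2 = -q ^ 2 * epsConv q (evenTheta q) 1 -
      charConv (evenTheta q) 0 := by
    have e1 := epsConv_add_three h0 h1 hs hrec (-1)
    have e2 := epsConv_reflect h0 h1 hs hr (-1)
    have e3 := charConv_add_two (evenTheta q) 0
    norm_num at e1 e2 e3
    rw [c1] at e2
    rw [e1, e2]
    unfold charConv at *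
    rw [e3]
    norm_cast
    ring
  have main := epsConv_mul_sub_appell h0 h1 le_rfl (by norm_num) hs hs' hrec hκ
  rw [tsum_evenTheta h0 h1] at main
  have e : ∀ n, thetaSeq q 6 (epsConv q (evenTheta q) 0 - charConv (evenTheta q) 0 / 2 * 2)
      (epsConv q (evenTheta q) 1 - charConv (evenTheta q) 0 / 2 * 0)
      (epsConv q (evenTheta q) 2 + charConv (evenTheta q) 0 / 2 * 2) n * q ^ n =
      epsConv q (evenTheta q) 1 * (evenTheta q n * q ^ n) +
        (-charConv (evenTheta q) 0 / 2) * (thetaSeq q 6 1 0 0 n * q ^ n) := by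
    intro n
    rw [evenTheta, ← mul_assoc, ← mul_assoc, ← add_mul, ← thetaSeq_linear, y0, y2]
    congr 2 <;> ring
  have s1 : Summable fun n => thetaSeq q 6 1 0 0 n * q ^ n :=
    (summable_norm_thetaSeq_mul_zpow h0 h1 le_rfl (by norm_num) _ _ _).of_norm
  rw [tsum_congr e, (hs'.of_norm.mul_left _).tsum_add (s1.mul_left _), tsum_mul_left,
    tsum_mul_left, tsum_evenTheta h0 h1, tsum_thetaSeq_mul_zpow h0 h1 le_rfl (by norm_num)] at main
  have e4 : ∑' k : ℤ, (1 * q ^ (6 * k ^ 2 + (6 - 6) * k + 3 * k) +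
      0 * q ^ (6 * k ^ 2 + (6 - 6) * k + 4 * k + 3 * k + 1) +
      0 * q ^ (6 * k ^ 2 + (6 - 6) * k + 8 * k + 3 * k + 2)) =
      ∑' k : ℤ, q ^ (6 * k ^ 2 + 3 * k + 0) := by
    refine tsum_congr fun k => ?_
    rw [zero_mul, zero_mul, add_zero, add_zero, one_mul]
    congr 1
    ring
  rw [e4] at main
  rw [evenLambert_eq h0 h1, epsSum]
  linear_combination -2 * main

/-- Here the three initial values of the remainder are exactly proportional to those of `oddTheta`,
so no further theta series appears. -/
theorem charConv_mul_oddLambert {q : ℂ} (h0 : q ≠ 0) (h1 : ‖q‖ < 1) :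
    charConv (oddTheta q) 0 * oddLambert q =
      -((q⁻¹ * pentSum q) *
        (epsSum q - (epsConv q (oddTheta q) 0 - charConv (oddTheta q) 0))) := by
  have hs : Summable fun j => ‖oddTheta q j‖ :=
    summable_norm_thetaSeq h0 h1 (by norm_num) le_rfl _ _ _
  have hs' : Summable fun j => ‖oddTheta q j * q ^ j‖ :=
    summable_norm_thetaSeq_mul_zpow h0 h1 (by norm_num) le_rfl _ _ _
  have hrec : ∀ n, oddTheta q (n + 3) = q ^ (4 * n + 8) * oddTheta q n :=
    thetaSeq_add_three h0 _ _ _ _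
  have hr := oddTheta_reflect h0
  have c1 : charConv (oddTheta q) 1 = -charConv (oddTheta q) 0 := by
    have e1 := charConv_reflect hr 0
    have e2 := charConv_add_two (oddTheta q) (-1)
    norm_num at e1 e2
    rw [e2, e1]
  have hκ : ∀ n, charConv (oddTheta q) n = charConv (oddTheta q) 0 * altSeq 1 (-1) n := by
    intro n
    rw [eq_altSeq (charConv_add_two (oddTheta q)) n, c1]
    unfold altSeq
    split_ifs <;> ring
  have y1 : epsConv q (oddTheta q) 1 = -charConv (oddTheta q) 0 := by
    have e1 := epsConv_add_three h0 h1 hs hrec (-2)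
    have e2 := epsConv_reflect h0 h1 hs hr (-2)
    norm_num at e1 e2
    have c1' := c1
    unfold charConv at c1'
    rw [c1'] at e1
    rw [c1] at e2
    unfold charConv at *
    linear_combination (e1 + e2) / 2
  have y2 : epsConv q (oddTheta q) 2 = -q ^ 4 * (epsConv q (oddTheta q) 0 -
      charConv (oddTheta q) 0) - charConv (oddTheta q) 0 := by
    have e1 := epsConv_add_three h0 h1 hs hrec (-1)
    have e2 := epsConv_reflect h0 h1 hs hr (-1)
    have e3 := charConv_add_two (oddTheta q) 0
    norm_num at e1 e2 e3
    rw [e1, e2]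
    unfold charConv at *
    rw [e3]
    norm_cast
    ring
  have main := epsConv_mul_sub_appell h0 h1 (by norm_num) le_rfl hs hs' hrec hκ
  rw [tsum_oddTheta h0 h1] at main
  have e : ∀ n, thetaSeq q 8 (epsConv q (oddTheta q) 0 - charConv (oddTheta q) 0 * 1)
      (epsConv q (oddTheta q) 1 - charConv (oddTheta q) 0 * -1)
      (epsConv q (oddTheta q) 2 + charConv (oddTheta q) 0 * 1) n * q ^ n =
      (epsConv q (oddTheta q) 0 - charConv (oddTheta q) 0) * (oddTheta q n * q ^ n) := by
    intro n
    have := thetaSeq_linear q 8 (epsConv q (oddTheta q) 0 - charConv (oddTheta q) 0) 0 1 0 (-q ^ 4)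
      0 0 0 n
    simp only [zero_mul, add_zero, mul_zero, mul_one] at this
    rw [oddTheta, ← mul_assoc, ← this, y1, y2]
    ring_nf
  rw [tsum_congr e, tsum_mul_left, tsum_oddTheta h0 h1] at main
  rw [oddLambert_eq h0 h1, epsSum]
  linear_combination -main

/-! ### Behaviour under q ↦ iq -/

open Complex in
theorem I_mul_zpow (q : ℂ) (n : ℤ) : (I * q) ^ (4 * n) = q ^ (4 * n) := by
  rw [mul_zpow, zpow_mul, show (4 : ℤ) = ((4 : ℕ) : ℤ) by norm_num, zpow_natCast, I_pow_four,
    one_zpow, one_mul]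

open Complex in
theorem eps_I_mul (q : ℂ) (l : ℤ) : eps (I * q) l = eps q l := by
  unfold eps
  rw [I_mul_zpow]

open Complex in
theorem evenTheta_I_mul {q : ℂ} (h0 : q ≠ 0) (n : ℤ) :
    evenTheta (I * q) n = -((-1) ^ n * evenTheta q n) := by
  have hI : I * q ≠ 0 := mul_ne_zero I_ne_zero h0
  have := eq_thetaSeq (h := 6) (X := fun n => -((-1) ^ n * evenTheta q n)) hI (fun n => by
    have e1 : evenTheta q (n + 3) = q ^ (4 * n + 6) * evenTheta q n :=
      thetaSeq_add_three h0 _ _ _ _ _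
    have e2 : (I * q) ^ (4 * n + 6) = -q ^ (4 * n + 6) := by
      rw [zpow_add₀ hI, I_mul_zpow, zpow_add₀ h0, show (6 : ℤ) = ((6 : ℕ) : ℤ) by norm_num,
        zpow_natCast, zpow_natCast, mul_pow, show I ^ 6 = -1 by
          rw [show 6 = 4 + 2 by norm_num, pow_add, I_pow_four, I_sq, one_mul]]
      ring
    rw [e1, e2, zpow_add₀ (by norm_num : (-1 : ℂ) ≠ 0)]
    norm_num
    ring) n
  rw [this]
  unfold evenTheta
  congr 1
  · simp [thetaSeq]
  · simp [thetaSeq]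
  · norm_num [thetaSeq, mul_pow]

open Complex in
theorem oddTheta_I_mul {q : ℂ} (h0 : q ≠ 0) (n : ℤ) : oddTheta (I * q) n = oddTheta q n := by
  have hI : I * q ≠ 0 := mul_ne_zero I_ne_zero h0
  have := eq_thetaSeq (h := 8) (X := oddTheta q) hI (fun n => by
    rw [show 4 * n + 8 = 4 * (n + 2) by ring, I_mul_zpow, show 4 * (n + 2) = 4 * n + 8 by ring]
    exact thetaSeq_add_three h0 _ _ _ _ _) n
  rw [this]
  unfold oddTheta
  congr 1
  · simp [thetaSeq]
  · simp [thetaSeq]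
  · simp [thetaSeq, mul_pow]

theorem altSeq_zero_one_of_even {l : ℤ} (h : l % 2 = 0) : altSeq 0 1 l = 0 := by
  have : l % 4 = 0 ∨ l % 4 = 2 := by omega
  unfold altSeq
  rcases this with e | e <;> simp [e]

open Complex in
theorem charConv_evenTheta_I_mul {q : ℂ} (h0 : q ≠ 0) :
    charConv (evenTheta (I * q)) 0 = charConv (evenTheta q) 0 := by
  unfold charConv
  refine tsum_congr fun j => ?_
  rw [evenTheta_I_mul h0]
  -- χ sees only odd arguments, so just one parity of j contributes and the sign (-1)^j is constant
  -- on it.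
  rcases Int.even_or_odd j with h | h
  · rw [altSeq_zero_one_of_even (l := 0 - j) (by rw [Int.even_iff] at h; omega)]
    ring
  · rw [h.neg_one_zpow]
    ring

open Complex in
theorem epsConv_evenTheta_I_mul {q : ℂ} (h0 : q ≠ 0) :
    epsConv (I * q) (evenTheta (I * q)) 1 = -epsConv q (evenTheta q) 1 := by
  unfold epsConv
  rw [← tsum_neg]
  refine tsum_congr fun j => ?_
  rw [evenTheta_I_mul h0, eps_I_mul]
  rcases Int.even_or_odd j with h | h
  · rw [h.neg_one_zpow]
    ring
  · rw [eps, altSeq_zero_one_of_even (l := 1 - j) (by rw [Int.odd_iff] at h; omega)]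
    ring

open Complex in
theorem charConv_oddTheta_I_mul {q : ℂ} (h0 : q ≠ 0) :
    charConv (oddTheta (I * q)) 0 = charConv (oddTheta q) 0 := by
  unfold charConv
  exact tsum_congr fun j => by rw [oddTheta_I_mul h0]

open Complex in
theorem epsConv_oddTheta_I_mul {q : ℂ} (h0 : q ≠ 0) :
    epsConv (I * q) (oddTheta (I * q)) 0 = epsConv q (oddTheta q) 0 := by
  unfold epsConv
  exact tsum_congr fun j => by rw [oddTheta_I_mul h0, eps_I_mul]

theorem one_sub_pow_ne_zero {q : ℂ} (h1 : ‖q‖ < 1) {n : ℕ} (hn : n ≠ 0) : 1 - q ^ n ≠ 0 := by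
  intro h
  have h2 : ‖q‖ ^ n = 1 := by
    rw [← norm_pow, ← sub_eq_zero.1 h, norm_one]
  exact absurd h2 (pow_lt_one₀ (norm_nonneg _) h1 hn).ne

theorem altSeq_zero_one_odd (n : ℕ) : altSeq 0 1 (2 * n + 1) = (-1) ^ n := by
  induction n with
  | zero => norm_num [altSeq]
  | succ n ih =>
    rw [show (2 * ((n + 1 : ℕ) : ℤ) + 1) = 2 * n + 1 + 2 by push_cast; ring, altSeq_add_two, ih,
      pow_succ]
    ring

theorem tsum_int_eq_tsum_nat {G : ℤ → ℂ} (hG : Summable G) :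
    ∑' l, G l = ∑' n : ℕ, (G n + G (-(n + 1))) := by
  have s1 : Summable fun k : ℕ => G k := hG.comp_injective Nat.cast_injective
  have s2 : Summable fun k : ℕ => G (-(k + 1 : ℤ)) :=
    hG.comp_injective (i := fun k : ℕ => -(k + 1 : ℤ)) fun a b h => by simpa using h
  rw [tsum_of_nat_of_neg_add_one s1 s2, ← s1.tsum_add s2]

theorem tsum_int_eq_tsum_odd {F : ℤ → ℂ} (hF : Summable F) (hz : ∀ l : ℤ, l % 2 = 0 → F l = 0) :
    ∑' l, F l = ∑' n : ℕ, (F (2 * n + 1) + F (-(2 * n + 1))) := by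
  have hi : Function.Injective fun k : ℤ => 2 * k + 1 := fun a b h => by simpa using h
  rw [← hi.tsum_eq (f := F)]
  · have hs' : Summable fun k : ℤ => F (2 * k + 1) := hF.comp_injective hi
    rw [tsum_int_eq_tsum_nat hs']
    refine tsum_congr fun n => ?_
    rw [show 2 * (-((n : ℤ) + 1)) + 1 = -(2 * n + 1) by ring]
  · intro l hl
    rcases Int.even_or_odd l with h | ⟨k, h⟩
    · exact absurd (hz l (Int.even_iff.1 h)) hl
    · exact ⟨k, h.symm⟩

theorem tsum_swap {f : ℕ → ℕ → ℂ} (h : Summable fun p : ℕ × ℕ => f p.1 p.2) :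
    ∑' n, ∑' m, f n m = ∑' m, ∑' n, f n m :=
  (Summable.tsum_comm (f := f) h).symm

/-- Pairing l with -l, where Q = q^l, gives (Q + Q^3)/(1 - Q^4) = Q/(1 - Q^2). -/
theorem epsSum_eq {q : ℂ} (h0 : q ≠ 0) (h1 : ‖q‖ < 1) :
    epsSum q = ∑' n : ℕ, (-1) ^ n * (q ^ (2 * n + 1) / (1 - (q ^ (2 * n + 1)) ^ 2)) := by
  unfold epsSum
  rw [tsum_int_eq_tsum_odd (summable_norm_eps_mul_zpow h0 h1).of_norm fun l hl => by
    rw [eps, altSeq_zero_one_of_even hl, zero_div, zero_mul]]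
  refine tsum_congr fun n => ?_
  have hne2 := one_sub_pow_ne_zero h1 (n := (2 * n + 1) * 2) (by omega)
  have hne4 := one_sub_pow_ne_zero h1 (n := (2 * n + 1) * 4) (by omega)
  have hQ : q ^ (2 * n + 1) ≠ 0 := pow_ne_zero _ h0
  have e' : q ^ (2 * (n : ℤ) + 1) = q ^ (2 * n + 1) := by rw [← zpow_natCast]; push_cast; rfl
  rw [eps_neg h0 h1, zpow_neg, e', eps, altSeq_zero_one_odd, mul_comm (4 : ℤ), zpow_mul, e',
    show (4 : ℤ) = ((4 : ℕ) : ℤ) by norm_num, zpow_natCast]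
  rw [pow_mul] at hne2 hne4
  generalize q ^ (2 * n + 1) = Q at *
  field_simp
  ring

open Complex in
-- As a double series the sum is ∑ (-1)^n q^((2n+1)(2m+1)). The rotation contributes i (-1)^(n+m),
-- moving the sign from n to m, and the exponent is symmetric in n and m.
theorem epsSum_I_mul {q : ℂ} (h0 : q ≠ 0) (h1 : ‖q‖ < 1) : epsSum (I * q) = I * epsSum q := by
  have hI : I * q ≠ 0 := mul_ne_zero I_ne_zero h0
  have hI1 : ‖I * q‖ < 1 := by simpa using h1
  have hr : 0 < ‖q‖ := norm_pos_iff.2 h0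
  have hQ : ∀ n : ℕ, ‖(q ^ (2 * n + 1)) ^ 2‖ < 1 := by
    intro n
    rw [← pow_mul, norm_pow]
    exact pow_lt_one₀ hr.le h1 (by omega)
  have hsum : Summable fun p : ℕ × ℕ => (-1) ^ p.1 * q ^ ((2 * p.1 + 1) * (2 * p.2 + 1)) := by
    refine Summable.of_norm_bounded ((summable_geometric_of_lt_one hr.le h1).mul_of_nonneg
      (summable_geometric_of_lt_one hr.le h1) (fun _ => by positivity) fun _ => by positivity) ?_
    rintro ⟨n, m⟩
    rw [norm_mul, norm_pow, norm_pow, norm_neg, norm_one, one_pow, one_mul, ← pow_add]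
    exact pow_le_pow_of_le_one hr.le h1.le (by nlinarith)
  have e1 : ∀ n : ℕ, (-1) ^ n * (q ^ (2 * n + 1) / (1 - (q ^ (2 * n + 1)) ^ 2)) =
      ∑' m : ℕ, (-1) ^ n * q ^ ((2 * n + 1) * (2 * m + 1)) := by
    intro n
    rw [tsum_mul_left, div_eq_mul_inv, ← tsum_geometric_of_norm_lt_one (hQ n), ← tsum_mul_left]
    congr 1
    refine tsum_congr fun m => ?_
    rw [← pow_mul, ← pow_mul, ← pow_add]
    congr 1
    ring
  have e2 : ∀ n : ℕ, q ^ (2 * n + 1) / (1 + (q ^ (2 * n + 1)) ^ 2) =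
      ∑' m : ℕ, (-1) ^ m * q ^ ((2 * n + 1) * (2 * m + 1)) := by
    intro n
    have h2 : ‖-(q ^ (2 * n + 1)) ^ 2‖ < 1 := by rw [norm_neg]; exact hQ n
    rw [div_eq_mul_inv, ← sub_neg_eq_add, ← tsum_geometric_of_norm_lt_one h2, ← tsum_mul_left]
    refine tsum_congr fun m => ?_
    rw [neg_pow, ← pow_mul, ← pow_mul, mul_left_comm, ← pow_add]
    congr 2
    ring
  have e3 : ∀ n : ℕ, (-1) ^ n * ((I * q) ^ (2 * n + 1) / (1 - ((I * q) ^ (2 * n + 1)) ^ 2)) =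
      I * (q ^ (2 * n + 1) / (1 + (q ^ (2 * n + 1)) ^ 2)) := by
    intro n
    have hi : I ^ (2 * n + 1) = (-1) ^ n * I := by rw [pow_succ, pow_mul, I_sq]
    have hn : ((-1 : ℂ) ^ n) ^ 2 = 1 := by rw [← pow_mul, mul_comm, pow_mul]; norm_num
    rw [mul_pow, hi, mul_pow, mul_pow, hn, I_sq]
    have : ∀ x y : ℂ, (-1) ^ n * ((-1) ^ n * I * x / y) = ((-1) ^ n) ^ 2 * (I * (x / y)) := by
      intro x y; ring
    rw [this, hn]
    ring_nf
  rw [epsSum_eq hI hI1, epsSum_eq h0 h1, tsum_congr e3, tsum_mul_left, tsum_congr e1,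
    tsum_congr e2, tsum_swap (f := fun n m : ℕ => (-1) ^ n * q ^ ((2 * n + 1) * (2 * m + 1))) hsum]
  congr 1
  refine tsum_congr fun n => tsum_congr fun m => ?_
  rw [mul_comm (2 * m + 1)]

/-! ### Nonvanishing of the character convolutions for small q -/

theorem norm_tsum_sub_le {f : ℤ → ℂ} {r : ℝ} (h0 : 0 ≤ r) (h1 : r ≤ 1 / 4) (hz : f 0 = 0)
    (hf : ∀ j, j ≠ 1 → j ≠ -1 → ‖f j‖ ≤ r ^ j.natAbs) :
    ‖∑' j, f j - (f 1 + f (-1))‖ ≤ 3 * r := by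
  have hh : HasSum (fun j : ℤ => r * (1 / 2 : ℝ) ^ j.natAbs) (3 * r) := by
    have a1 : HasSum (fun n : ℕ => (1 / 2 : ℝ) ^ ((n : ℤ)).natAbs) 2 := by
      simpa using hasSum_geometric_two
    have a2 : HasSum (fun n : ℕ => (1 / 2 : ℝ) ^ (-((n : ℤ) + 1)).natAbs) 1 := by
      have := hasSum_geometric_two.mul_left (1 / 2 : ℝ)
      rw [show (1 / 2 : ℝ) * 2 = 1 by norm_num] at this
      refine this.congr_fun fun n => ?_
      rw [show (-((n : ℤ) + 1)).natAbs = n + 1 by omega, pow_succ']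
    have := (HasSum.of_nat_of_neg_add_one (f := fun j : ℤ => (1 / 2 : ℝ) ^ j.natAbs) a1
      a2).mul_left r
    rwa [show r * (2 + 1) = 3 * r by ring] at this
  have hg : ∀ j, ‖if j = 1 ∨ j = -1 then 0 else f j‖ ≤ r * (1 / 2 : ℝ) ^ j.natAbs := by
    intro j
    by_cases hj : j = 1 ∨ j = -1
    · rw [if_pos hj, norm_zero]; positivity
    rw [if_neg hj]
    push Not at hj
    rcases eq_or_ne j 0 with rfl | hj0
    · rw [hz, norm_zero]; positivity
    refine (hf j hj.1 hj.2).trans ?_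
    obtain ⟨n, hn⟩ : ∃ n, j.natAbs = n + 2 := ⟨j.natAbs - 2, by omega⟩
    rw [hn, pow_succ']
    refine mul_le_mul_of_nonneg_left ?_ h0
    calc r ^ (n + 1) ≤ (1 / 4 : ℝ) ^ (n + 1) := pow_le_pow_left₀ h0 h1 _
      _ = (1 / 2 : ℝ) ^ (2 * (n + 1)) := by rw [pow_mul]; norm_num
      _ ≤ (1 / 2 : ℝ) ^ (n + 2) :=
        pow_le_pow_of_le_one (by norm_num) (by norm_num) (by omega)
  have hs : Summable fun j : ℤ => if j = 1 ∨ j = -1 then 0 else f j :=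
    Summable.of_norm_bounded hh.summable hg
  have he : ∑' j, f j = f 1 + f (-1) + ∑' j, if j = 1 ∨ j = -1 then 0 else f j := by
    have e1 : ∀ j, f j = (if j = 1 then f 1 else 0) + (if j = -1 then f (-1) else 0) +
        if j = 1 ∨ j = -1 then 0 else f j := by
      intro j
      by_cases h1 : j = 1
      · subst h1; norm_num
      by_cases h2 : j = -1
      · subst h2; norm_num
      simp [h1, h2]
    have s1 := (hasSum_ite_eq (1 : ℤ) (f 1)).add (hasSum_ite_eq (-1 : ℤ) (f (-1)))
    rw [tsum_congr e1, s1.summable.tsum_add hs, s1.tsum_eq]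
  rw [he, add_sub_cancel_left]
  exact (norm_tsum_le_tsum_norm hs.norm).trans
    ((hs.norm.tsum_le_tsum hg hh.summable).trans hh.tsum_eq.le)

theorem norm_thetaSeq_le_pow {q : ℂ} (h0 : q ≠ 0) (h1 : ‖q‖ ≤ 1) {h : ℤ} {a b c : ℂ} {j e : ℤ}
    {x : ℂ} (hx : ‖x‖ ≤ 1) (hj : thetaSeq q h a b c j = x * q ^ e) (he : j.natAbs ≤ e) :
    ‖thetaSeq q h a b c j‖ ≤ ‖q‖ ^ j.natAbs := by
  rw [hj, norm_mul, norm_zpow]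
  calc ‖x‖ * ‖q‖ ^ e ≤ 1 * ‖q‖ ^ e := by gcongr
    _ ≤ ‖q‖ ^ (j.natAbs : ℤ) := by
      rw [one_mul]; exact zpow_le_zpow_right_of_le_one₀ (norm_pos_iff.2 h0) h1 he
    _ = _ := zpow_natCast _ _

theorem norm_evenTheta_le {q : ℂ} (h0 : q ≠ 0) (h1 : ‖q‖ ≤ 1) {j : ℤ} (hj : j ≠ 1)
    (hj' : j ≠ -1) : ‖evenTheta q j‖ ≤ ‖q‖ ^ j.natAbs := by
  have h3 : j % 3 = 0 ∨ j % 3 = 1 ∨ j % 3 = 2 := by omega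
  have hk : j = 3 * (j / 3) + j % 3 := by omega
  rcases h3 with e | e | e
  · simp [evenTheta, thetaSeq, e]
  · refine norm_thetaSeq_le_pow (x := 1) (e := 6 * (j / 3) ^ 2 + 4 * (j / 3)) h0 h1 (by simp) ?_ ?_
    · simp [thetaSeq, e]
    · rw [e] at hk
      generalize j / 3 = k at *
      have : k ≠ 0 := by omega
      rcases lt_or_gt_of_ne this with h | h
      · rw [show (j.natAbs : ℤ) = -(3 * k + 1) by omega]; nlinarith
      · rw [show (j.natAbs : ℤ) = 3 * k + 1 by omega]; nlinarith
  · refine norm_thetaSeq_le_pow (x := -1) (e := 2 + (6 * (j / 3) ^ 2 + 8 * (j / 3))) h0 h1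
      (by simp) ?_ ?_
    · simp [thetaSeq, e, zpow_add₀ h0 2]
    · rw [e] at hk
      generalize j / 3 = k at *
      have : k ≠ -1 := by omega
      rcases lt_or_gt_of_ne this with h | h
      · rw [show (j.natAbs : ℤ) = -(3 * k + 2) by omega]; nlinarith
      · rw [show (j.natAbs : ℤ) = 3 * k + 2 by omega]; nlinarith

theorem norm_oddTheta_le {q : ℂ} (h0 : q ≠ 0) (h1 : ‖q‖ ≤ 1) {j : ℤ} (hj' : j ≠ -1) :
    ‖oddTheta q j‖ ≤ ‖q‖ ^ j.natAbs := by
  have h3 : j % 3 = 0 ∨ j % 3 = 1 ∨ j % 3 = 2 := by omega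
  have hk : j = 3 * (j / 3) + j % 3 := by omega
  rcases h3 with e | e | e
  · refine norm_thetaSeq_le_pow (x := 1) (e := 6 * (j / 3) ^ 2 + 2 * (j / 3)) h0 h1 (by simp) ?_ ?_
    · simp [thetaSeq, e]
    · rw [e] at hk
      generalize j / 3 = k at *
      rcases lt_or_ge k 0 with h | h
      · rw [show (j.natAbs : ℤ) = -(3 * k) by omega]; nlinarith
      · rw [show (j.natAbs : ℤ) = 3 * k by omega]; nlinarith
  · simp [oddTheta, thetaSeq, e]
  · refine norm_thetaSeq_le_pow (x := -1) (e := 4 + (6 * (j / 3) ^ 2 + 2 * (j / 3) + 8 * (j / 3)))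
      h0 h1 (by simp) ?_ ?_
    · simp [thetaSeq, e, zpow_add₀ h0 4]
    · rw [e] at hk
      generalize j / 3 = k at *
      have : k ≠ -1 := by omega
      rcases lt_or_gt_of_ne this with h | h
      · rw [show (j.natAbs : ℤ) = -(3 * k + 2) by omega]; nlinarith
      · rw [show (j.natAbs : ℤ) = 3 * k + 2 by omega]; nlinarith

/-- The terms j = ±1 add up to -2, while all others together are at most 3|q| ≤ 3/16. -/
theorem charConv_evenTheta_ne_zero {q : ℂ} (h0 : q ≠ 0) (h1 : ‖q‖ ≤ 1 / 16) :
    charConv (evenTheta q) 0 ≠ 0 := by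
  have := norm_tsum_sub_le (f := fun j => evenTheta q j * altSeq 0 1 (0 - j)) (norm_nonneg q)
    (h1.trans (by norm_num)) (by simp [altSeq]) fun j hj hj' => by
      rw [norm_mul]
      refine (mul_le_of_le_one_right (norm_nonneg _) ?_).trans
        (norm_evenTheta_le h0 (h1.trans (by norm_num)) hj hj')
      simpa using norm_altSeq_le 0 1 (0 - j)
  have e1 : evenTheta q 1 = 1 := by norm_num [evenTheta, thetaSeq]
  have e2 : evenTheta q (-1) = -1 := by rw [← zero_sub, evenTheta_reflect h0, e1]
  intro h
  unfold charConv at h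
  simp only [h, e1, e2] at this
  norm_num [altSeq] at this
  linarith

theorem charConv_oddTheta_ne_zero {q : ℂ} (h0 : q ≠ 0) (h1 : ‖q‖ ≤ 1 / 16) :
    charConv (oddTheta q) 0 ≠ 0 := by
  have := norm_tsum_sub_le (f := fun j => oddTheta q j * altSeq 0 1 (0 - j)) (norm_nonneg q)
    (h1.trans (by norm_num)) (by simp [altSeq]) fun j hj hj' => by
      rw [norm_mul]
      refine (mul_le_of_le_one_right (norm_nonneg _) ?_).trans
        (norm_oddTheta_le h0 (h1.trans (by norm_num)) hj')
      simpa using norm_altSeq_le 0 1 (0 - j)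
  have e1 : oddTheta q 1 = 0 := by norm_num [oddTheta, thetaSeq]
  have e0 : oddTheta q 0 = 1 := by norm_num [oddTheta, thetaSeq]
  have e2 : oddTheta q (-1) = -1 := by
    have := oddTheta_reflect h0 0
    rwa [sub_zero, e0] at this
  intro h
  unfold charConv at h
  simp only [h, e1, e2] at this
  norm_num [altSeq] at this
  linarith

/-! ### Finite q-products and partial fractions -/

/-- The finite product `(1 - q) (1 - q ^ 2) ⋯ (1 - q ^ n)`. -/
noncomputable def qFactorial (q : ℂ) (n : ℕ) : ℂ := ∏ i ∈ Finset.range n, (1 - q ^ (i + 1))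

theorem qFactorial_succ (q : ℂ) (n : ℕ) :
    qFactorial q (n + 1) = qFactorial q n * (1 - q ^ (n + 1)) := by
  rw [qFactorial, Finset.prod_range_succ, qFactorial]

theorem qFactorial_ne_zero {q : ℂ} (h1 : ‖q‖ < 1) (n : ℕ) : qFactorial q n ≠ 0 :=
  Finset.prod_ne_zero_iff.2 fun _ _ => one_sub_pow_ne_zero h1 (Nat.succ_ne_zero _)

theorem half_le_norm_qFactorial {q : ℂ} (h1 : ‖q‖ ≤ 1 / 16) (n : ℕ) :
    1 / 2 ≤ ‖qFactorial q n‖ := by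
  have hr := norm_nonneg q
  -- The extra term makes the bound inductive: multiplying by 1 - |q|^(n+1) uses up only part of it.
  have key : 1 / 2 + ‖q‖ ^ n / 2 ≤ ‖qFactorial q n‖ := by
    induction n with
    | zero => norm_num [qFactorial]
    | succ n ih =>
      have h2 : 1 - ‖q‖ ^ (n + 1) ≤ ‖1 - q ^ (n + 1)‖ := by
        have := norm_sub_norm_le (1 : ℂ) (q ^ (n + 1))
        simpa using this
      have h3 : ‖q‖ ^ n ≤ 1 := pow_le_one₀ hr (h1.trans (by norm_num))
      have h4 : 0 ≤ ‖q‖ ^ n := by positivity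
      rw [qFactorial_succ, norm_mul]
      have h5 : 0 ≤ 1 - ‖q‖ ^ (n + 1) := by rw [pow_succ]; nlinarith
      calc 1 / 2 + ‖q‖ ^ (n + 1) / 2 ≤ (1 / 2 + ‖q‖ ^ n / 2) * (1 - ‖q‖ ^ (n + 1)) := by
            rw [pow_succ]
            generalize ‖q‖ ^ n = x at *
            generalize ‖q‖ = r at *
            nlinarith [mul_nonneg h4 hr, mul_nonneg (mul_nonneg h4 hr) (sub_nonneg.2 h3),
              mul_nonneg h4 (sub_nonneg.2 h1)]
        _ ≤ _ := mul_le_mul ih h2 h5 (norm_nonneg _)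
  have : 0 ≤ ‖q‖ ^ n := by positivity
  linarith

theorem norm_inv_qFactorial_le {q : ℂ} (h1 : ‖q‖ ≤ 1 / 16) (n : ℕ) :
    ‖(qFactorial q n)⁻¹‖ ≤ 2 := by
  rw [norm_inv, inv_le_comm₀ (by linarith [half_le_norm_qFactorial h1 n]) two_pos]
  have := half_le_norm_qFactorial h1 n
  norm_num at this ⊢
  exact this

theorem triangle_succ (k : ℕ) : (k + 1) * (k + 1 + 1) / 2 = k * (k + 1) / 2 + (k + 1) := by
  rw [show (k + 1) * (k + 1 + 1) = k * (k + 1) + 2 * (k + 1) by ring,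
    Nat.add_mul_div_left _ _ two_pos]

/-- The coefficients of the partial fraction expansion `prod_inv_eq_sum`. -/
noncomputable def baileyCoeff (q : ℂ) (n k : ℕ) : ℂ :=
  (-1) ^ k * q ^ (k * (k + 1) / 2) * (1 - q ^ (2 * k + 1)) *
    ((qFactorial q (n - k))⁻¹ * (qFactorial q (n + k + 1))⁻¹)

/-- Closed form for the partial sums; the factor 1 - q^m kills the complete sum, where m = 0. -/
theorem sum_baileyCoeff_partial {q : ℂ} (h0 : q ≠ 0) (h1 : ‖q‖ < 1) {n : ℕ} (hn : n ≠ 0) (K m : ℕ)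
    (hK : n = K + m) :
    ∑ k ∈ Finset.range (K + 1), baileyCoeff q n k * (q ^ k)⁻¹ =
      (-1) ^ K * q ^ (K * (K + 1) / 2) * (1 - q ^ (K + 1)) * (1 - q ^ m) *
        ((1 - q ^ n)⁻¹ * (qFactorial q m)⁻¹ * (qFactorial q (n + K + 1))⁻¹) := by
  have hd := one_sub_pow_ne_zero h1 hn
  induction K generalizing m with
  | zero =>
    obtain rfl : n = m := by omega
    simp only [zero_add, Finset.sum_range_one, baileyCoeff, mul_zero, pow_zero, pow_one, one_mul,
      Nat.zero_div, Nat.sub_zero, add_zero, inv_one, mul_one]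
    field_simp
  | succ K ih =>
    have hf := qFactorial_ne_zero h1
    rw [Finset.sum_range_succ, ih (m + 1) (by omega), baileyCoeff,
      show n - (K + 1) = m by omega, triangle_succ, show n + (K + 1) + 1 = n + K + 1 + 1 by ring,
      qFactorial_succ q (n + K + 1), qFactorial_succ q m]
    have hm := one_sub_pow_ne_zero h1 (n := m + 1) (by omega)
    have hN := one_sub_pow_ne_zero h1 (n := n + K + 1 + 1) (by omega)
    have hf1 := hf m
    have hf2 := hf (n + K + 1)
    have hq := pow_ne_zero (K + 1) h0
    have e1 : q ^ n = q ^ (K + 1) * q ^ m := by rw [hK, pow_add]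
    have e2 : q ^ (n + K + 1 + 1) = q ^ (K + 1) * q ^ m * q ^ (K + 1) * q := by
      rw [← e1, ← pow_add, ← pow_succ, ← add_assoc]
    rw [e2] at hN ⊢
    rw [e1] at hd ⊢
    rw [pow_add q (K * (K + 1) / 2), pow_succ (-1 : ℂ),
      show 2 * (K + 1) + 1 = (K + 1) + (K + 1) + 1 by ring,
      pow_succ q (K + 1 + (K + 1)), pow_add q (K + 1) (K + 1), pow_succ q (K + 1),
      pow_succ q m] at *
    generalize q ^ (K + 1) = x at *
    generalize q ^ m = y at *
    generalize qFactorial q m = f at *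
    generalize qFactorial q (n + K + 1) = g at *
    have hN' : 1 - x ^ 2 * y * q ≠ 0 := by convert hN using 2; ring
    field_simp
    ring

/-- The residues in y of a product with at least two linear denominators sum to zero; here this is
read off the telescoped form. -/
theorem sum_baileyCoeff {q : ℂ} (h0 : q ≠ 0) (h1 : ‖q‖ < 1) {n : ℕ} (hn : n ≠ 0) :
    ∑ k ∈ Finset.range (n + 1), baileyCoeff q n k * (q ^ k)⁻¹ = 0 := by
  rw [sum_baileyCoeff_partial h0 h1 hn n 0 (by omega)]
  simp

/-- Induction on n: multiplying each simple fraction by the new factor splits it into two, and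
`sum_baileyCoeff` shows that the pieces at the new pole have the required total. -/
theorem prod_inv_eq_sum {q : ℂ} (h0 : q ≠ 0) (h1 : ‖q‖ < 1) {y : ℂ}
    (hy : ∀ j : ℕ, 1 + q ^ (2 * j + 1) - q ^ j * y ≠ 0) (n : ℕ) :
    ∏ j ∈ Finset.range (n + 1), (1 + q ^ (2 * j + 1) - q ^ j * y)⁻¹ =
      ∑ k ∈ Finset.range (n + 1), baileyCoeff q n k * (1 + q ^ (2 * k + 1) - q ^ k * y)⁻¹ := by
  induction n with
  | zero =>
    have := one_sub_pow_ne_zero h1 one_ne_zero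
    rw [pow_one] at this
    simp [baileyCoeff, qFactorial, this]
  | succ n ih =>
    have hu := sum_baileyCoeff h0 h1 (Nat.succ_ne_zero n)
    rw [Finset.sum_range_succ] at hu
    rw [Finset.prod_range_succ, ih, Finset.sum_range_succ _ (n + 1), Finset.sum_mul]
    have hq := pow_ne_zero (n + 1) h0
    have hlast : baileyCoeff q (n + 1) (n + 1) =
        -(q ^ (n + 1) * ∑ k ∈ Finset.range (n + 1), baileyCoeff q (n + 1) k * (q ^ k)⁻¹) := by
      rw [Nat.succ_eq_add_one] at hu
      rw [eq_neg_of_add_eq_zero_left hu]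
      field_simp
    rw [hlast, neg_mul, ← sub_eq_add_neg, Finset.mul_sum, Finset.sum_mul, ← Finset.sum_sub_distrib]
    refine Finset.sum_congr rfl fun k hk => ?_
    obtain ⟨m, rfl⟩ : ∃ m, n = k + m := ⟨n - k, by have := Finset.mem_range.1 hk; omega⟩
    have a1 := hy k
    have a2 := hy (k + m + 1)
    have hf := qFactorial_ne_zero h1
    have hb : baileyCoeff q (k + m) k =
        baileyCoeff q (k + m + 1) k * ((1 - q ^ (m + 1)) * (1 - q ^ (k + m + k + 1 + 1))) := by
      have b1 := one_sub_pow_ne_zero h1 (n := m + 1) (by omega)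
      have b2 := one_sub_pow_ne_zero h1 (n := k + m + k + 1 + 1) (by omega)
      have b3 := hf m
      have b4 := hf (k + m + k + 1)
      unfold baileyCoeff
      rw [show k + m - k = m by omega, show k + m + 1 - k = m + 1 by omega,
        show k + m + 1 + k + 1 = k + m + k + 1 + 1 by ring, qFactorial_succ q (k + m + k + 1),
        qFactorial_succ q m]
      field_simp
    have hk0 := pow_ne_zero k h0
    have e1 : q ^ (2 * (k + m + 1) + 1) = q ^ k * q ^ k * q ^ (m + 1) * q ^ (m + 1) * q := by
      ring
    have e2 : q ^ (k + m + 1) = q ^ k * q ^ (m + 1) := by ring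
    have e3 : q ^ (2 * k + 1) = q ^ k * q ^ k * q := by ring
    have e4 : q ^ (k + m + k + 1 + 1) = q ^ k * q ^ k * q ^ (m + 1) * q := by ring
    rw [e1, e2] at a2
    rw [e3] at a1
    rw [hb, e1, e2, e3, e4]
    clear hb e1 e2 e3 e4 hlast hu ih hy
    generalize q ^ k = x at *
    generalize q ^ (m + 1) = z at *
    generalize baileyCoeff q (k + m + 1) k = B at *
    have key : (1 - z) * (1 - x * x * z * q) = (1 + x * x * z * z * q - x * z * y) -
        z * (1 + x * x * q - x * y) := by ring
    rw [key]
    generalize 1 + x * x * z * z * q - x * z * y = b at *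
    generalize 1 + x * x * q - x * y = a at *
    field_simp

/-! ### Durfee sums and the Bailey-type interchange -/

/-- The series `∑ m, q ^ (m ^ 2 + a m) / ((q)_m (q)_{m + a})`, which does not depend on `a`. -/
noncomputable def durfeeSum (q : ℂ) (a : ℕ) : ℂ :=
  ∑' m : ℕ, q ^ (m ^ 2 + a * m) * ((qFactorial q m)⁻¹ * (qFactorial q (m + a))⁻¹)

theorem norm_pow_mul_inv_qFactorial_le {q : ℂ} (h1 : ‖q‖ ≤ 1 / 16) (e m n : ℕ) :
    ‖q ^ e * ((qFactorial q m)⁻¹ * (qFactorial q n)⁻¹)‖ ≤ 4 * ‖q‖ ^ e := by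
  rw [norm_mul, norm_mul, norm_pow, mul_comm]
  refine mul_le_mul_of_nonneg_right ?_ (by positivity)
  have := mul_le_mul (norm_inv_qFactorial_le h1 m) (norm_inv_qFactorial_le h1 n) (norm_nonneg _)
    zero_le_two
  linarith

theorem summable_pow_mul_inv_qFactorial {q : ℂ} (h1 : ‖q‖ ≤ 1 / 16) {e : ℕ → ℕ} (f g : ℕ → ℕ)
    (he : ∀ m, m ≤ e m) :
    Summable fun m => q ^ e m * ((qFactorial q (f m))⁻¹ * (qFactorial q (g m))⁻¹) := by
  have hq : ‖q‖ < 1 := h1.trans_lt (by norm_num)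
  refine Summable.of_norm_bounded ((summable_geometric_of_lt_one (norm_nonneg q) hq).mul_left 4)
    fun m => (norm_pow_mul_inv_qFactorial_le h1 _ _ _).trans ?_
  exact mul_le_mul_of_nonneg_left (pow_le_pow_of_le_one (norm_nonneg _) hq.le (he m)) (by norm_num)

theorem norm_durfeeSum_le {q : ℂ} (h1 : ‖q‖ ≤ 1 / 16) (a : ℕ) : ‖durfeeSum q a‖ ≤ 8 := by
  have h2 := hasSum_geometric_two.mul_left 4
  rw [show (4 : ℝ) * 2 = 8 by norm_num] at h2
  refine tsum_of_norm_bounded h2 fun m => (norm_pow_mul_inv_qFactorial_le h1 _ _ _).trans ?_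
  refine mul_le_mul_of_nonneg_left ?_ (by norm_num)
  calc ‖q‖ ^ (m ^ 2 + a * m) ≤ ‖q‖ ^ m :=
        pow_le_pow_of_le_one (norm_nonneg _) (h1.trans (by norm_num))
          (by nlinarith [Nat.le_self_pow two_ne_zero m])
    _ ≤ _ := pow_le_pow_left₀ (norm_nonneg _) (h1.trans (by norm_num)) _

theorem durfeeSum_sub {q : ℂ} (h1 : ‖q‖ ≤ 1 / 16) (a : ℕ) :
    durfeeSum q a - durfeeSum q (a + 1) =
      -q ^ (a + 1) * (durfeeSum q (a + 1) - durfeeSum q (a + 2)) := by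
  have hq : ‖q‖ < 1 := h1.trans_lt (by norm_num)
  have hf := qFactorial_ne_zero hq
  have hm : ∀ m : ℕ, m ≤ m ^ 2 := fun m => Nat.le_self_pow two_ne_zero m
  have s : ∀ a, Summable fun m =>
      q ^ (m ^ 2 + a * m) * ((qFactorial q m)⁻¹ * (qFactorial q (m + a))⁻¹) := fun a =>
    summable_pow_mul_inv_qFactorial h1 (fun m => m) (fun m => m + a)
      (fun m => by nlinarith [hm m])
  have d : ∀ a, durfeeSum q a - durfeeSum q (a + 1) =
      ∑' m : ℕ, q ^ (m ^ 2 + a * m) * ((1 - q ^ m) - q ^ (m + a + 1)) *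
        ((qFactorial q m)⁻¹ * (qFactorial q (m + a + 1))⁻¹) := by
    intro a
    unfold durfeeSum
    rw [← (s a).tsum_sub (s (a + 1))]
    refine tsum_congr fun m => ?_
    have b1 := one_sub_pow_ne_zero hq (n := m + a + 1) (by omega)
    have b2 := hf m
    have b3 := hf (m + a)
    rw [← add_assoc m a 1, qFactorial_succ q (m + a),
      show m ^ 2 + (a + 1) * m = m ^ 2 + a * m + m by ring,
      pow_add q (m ^ 2 + a * m) m]
    field_simp
    ring
  rw [d a, d (a + 1), ← tsum_mul_left]
  have s1 : Summable fun m : ℕ => q ^ (m ^ 2 + a * m) * (1 - q ^ m) *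
      ((qFactorial q m)⁻¹ * (qFactorial q (m + a + 1))⁻¹) := by
    refine ((summable_pow_mul_inv_qFactorial h1 (fun m => m) (fun m => m + a + 1)
      (fun m => show m ≤ m ^ 2 + a * m by nlinarith [hm m])).sub
      (summable_pow_mul_inv_qFactorial h1 (fun m => m) (fun m => m + a + 1)
      (fun m => show m ≤ m ^ 2 + a * m + m by nlinarith [hm m]))).congr fun m => ?_
    rw [pow_add q (m ^ 2 + a * m) m]
    ring
  have s2 : Summable fun m : ℕ => q ^ (m ^ 2 + a * m + (m + a + 1)) *
      ((qFactorial q m)⁻¹ * (qFactorial q (m + a + 1))⁻¹) :=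
    summable_pow_mul_inv_qFactorial h1 (fun m => m) (fun m => m + a + 1)
      (fun m => show m ≤ m ^ 2 + a * m + (m + a + 1) by nlinarith [hm m])
  have e : ∀ m : ℕ, q ^ (m ^ 2 + a * m) * ((1 - q ^ m) - q ^ (m + a + 1)) *
        ((qFactorial q m)⁻¹ * (qFactorial q (m + a + 1))⁻¹) =
      q ^ (m ^ 2 + a * m) * (1 - q ^ m) *
        ((qFactorial q m)⁻¹ * (qFactorial q (m + a + 1))⁻¹) -
      q ^ (m ^ 2 + a * m + (m + a + 1)) *
      ((qFactorial q m)⁻¹ * (qFactorial q (m + a + 1))⁻¹) := by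
    intro m
    rw [pow_add q (m ^ 2 + a * m) (m + a + 1)]
    ring
  rw [tsum_congr e, s1.tsum_sub s2, s1.tsum_eq_zero_add]
  have s1' := (summable_nat_add_iff 1).2 s1
  simp only [pow_zero, sub_self, mul_zero, zero_mul, zero_add]
  rw [← s1'.tsum_sub s2]
  refine tsum_congr fun m => ?_
  have b0 := one_sub_pow_ne_zero hq (n := m + 1) (by omega)
  have b1 := one_sub_pow_ne_zero hq (n := m + a + 1 + 1) (by omega)
  have b2 := hf m
  have b3 := hf (m + a + 1)
  rw [show m + 1 + a + 1 = m + a + 1 + 1 by ring, show m + (a + 1) + 1 = m + a + 1 + 1 by ring,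
    qFactorial_succ q (m + a + 1), qFactorial_succ q m]
  have e1 : q ^ ((m + 1) ^ 2 + a * (m + 1)) = q ^ (m ^ 2 + (a + 1) * m) * q ^ (a + 1) * q ^ m := by
    ring
  have e2 : q ^ (m ^ 2 + a * m + (m + a + 1)) = q ^ (m ^ 2 + (a + 1) * m) * q ^ (a + 1) := by
    ring
  rw [e1, e2]
  generalize q ^ (m ^ 2 + (a + 1) * m) = X
  generalize q ^ (a + 1) = Y
  generalize q ^ (m + a + 1 + 1) = Z at *
  generalize q ^ (m + 1) = U at *
  field_simp
  ring

/-- `durfeeSum_sub` expresses each consecutive difference as a small multiple of the next one. The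
differences are uniformly bounded, so iterating forces them to vanish. -/
theorem durfeeSum_eq {q : ℂ} (h1 : ‖q‖ ≤ 1 / 16) (a : ℕ) : durfeeSum q a = durfeeSum q 0 := by
  have hb : ∀ n a : ℕ, ‖durfeeSum q a - durfeeSum q (a + 1)‖ ≤ 16 * (1 / 2 : ℝ) ^ n := by
    intro n
    induction n with
    | zero =>
      intro a
      have := norm_sub_le (durfeeSum q a) (durfeeSum q (a + 1))
      have := norm_durfeeSum_le h1 a
      have := norm_durfeeSum_le h1 (a + 1)
      linarith
    | succ n ih =>
      intro a
      rw [durfeeSum_sub h1, norm_mul, norm_neg, norm_pow]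
      have h2 : ‖q‖ ^ (a + 1) ≤ 1 / 2 :=
        (pow_le_of_le_one (norm_nonneg _) (h1.trans (by norm_num)) (by omega)).trans
          (h1.trans (by norm_num))
      have := mul_le_mul h2 (ih (a + 1)) (norm_nonneg _) (by norm_num)
      rw [pow_succ (1 / 2 : ℝ)]
      linarith
  have hz : ∀ a, durfeeSum q a - durfeeSum q (a + 1) = 0 := by
    intro a
    have ht : Filter.Tendsto (fun n : ℕ => 16 * (1 / 2 : ℝ) ^ n) Filter.atTop (nhds (16 * 0)) :=
      (tendsto_pow_atTop_nhds_zero_of_lt_one (by norm_num) (by norm_num)).const_mul 16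
    rw [mul_zero] at ht
    exact norm_le_zero_iff.1 (ge_of_tendsto' ht fun n => hb n a)
  induction a with
  | zero => rfl
  | succ a ih => rw [← ih, sub_eq_zero.1 (hz a)]

theorem hasSum_antidiagonal {F : ℕ × ℕ → ℂ} (hF : Summable F) :
    HasSum (fun n => ∑ k ∈ Finset.range (n + 1), F (k, n - k)) (∑' p, F p) := by
  have h := (Equiv.hasSum_iff Finset.HasAntidiagonal.sigmaAntidiagonalEquivProd).2 hF.hasSum
  have h2 := h.sigma fun n => hasSum_fintype _
  refine h2.congr_fun fun n => ?_
  rw [← Finset.Nat.sum_antidiagonal_eq_sum_range_succ (fun i j => F (i, j)) n]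
  rw [← Finset.sum_coe_sort]
  rfl

theorem hasSum_bailey {q : ℂ} (h0 : q ≠ 0) (h1 : ‖q‖ ≤ 1 / 16) {φ : ℕ → ℂ} {M : ℝ}
    (hφ : ∀ k, ‖q ^ k * φ k‖ ≤ M) :
    HasSum (fun n => q ^ (n ^ 2 + n) * ∑ k ∈ Finset.range (n + 1), baileyCoeff q n k * φ k)
      (durfeeSum q 0 * ∑' k : ℕ, (-1) ^ k * q ^ (3 * (k * (k + 1) / 2)) * (1 - q ^ (2 * k + 1)) *
        φ k) := by
  have hq : ‖q‖ < 1 := h1.trans_lt (by norm_num)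
  have hr := norm_nonneg q
  let F : ℕ × ℕ → ℂ := fun p => q ^ ((p.1 + p.2) ^ 2 + (p.1 + p.2)) *
    ((-1) ^ p.1 * q ^ (p.1 * (p.1 + 1) / 2) * (1 - q ^ (2 * p.1 + 1)) *
    ((qFactorial q p.2)⁻¹ * (qFactorial q (p.2 + (2 * p.1 + 1)))⁻¹) * φ p.1)
  have hM : 0 ≤ M := (norm_nonneg _).trans (hφ 0)
  have hF : Summable F := by
    refine Summable.of_norm_bounded (((summable_geometric_of_lt_one hr hq).mul_of_nonneg
      (summable_geometric_of_lt_one hr hq) (fun _ => by positivity)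
      fun _ => by positivity).mul_left (8 * M)) ?_
    rintro ⟨k, m⟩
    have e : F (k, m) = (q ^ ((k + m) ^ 2 + m + k * (k + 1) / 2) *
        ((qFactorial q m)⁻¹ * (qFactorial q (m + (2 * k + 1)))⁻¹)) *
        ((-1) ^ k * ((1 - q ^ (2 * k + 1)) * (q ^ k * φ k))) := by
      simp only [F]
      rw [show (k + m) ^ 2 + (k + m) = (k + m) ^ 2 + m + k by ring, pow_add q _ k,
        pow_add q _ (k * (k + 1) / 2)]
      ring
    rw [e, norm_mul, norm_mul ((-1) ^ k), norm_mul (1 - _), norm_pow, norm_neg, norm_one, one_pow,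
      one_mul]
    have h2 : ‖1 - q ^ (2 * k + 1)‖ ≤ 2 := by
      refine (norm_sub_le _ _).trans ?_
      have : ‖q‖ ^ (2 * k + 1) ≤ 1 := pow_le_one₀ hr hq.le
      rw [norm_one, norm_pow]
      linarith
    have h3 : ‖q‖ ^ ((k + m) ^ 2 + m + k * (k + 1) / 2) ≤ ‖q‖ ^ k * ‖q‖ ^ m := by
      rw [← pow_add]
      refine pow_le_pow_of_le_one hr hq.le ?_
      have := Nat.le_self_pow two_ne_zero (k + m)
      omega
    have h4 := mul_le_mul h2 (hφ k) (norm_nonneg _) zero_le_two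
    have h5 := mul_le_mul ((norm_pow_mul_inv_qFactorial_le h1 ((k + m) ^ 2 + m + k * (k + 1) / 2) m
      (m + (2 * k + 1))).trans (mul_le_mul_of_nonneg_left h3 (by norm_num))) h4
      (by positivity) (by positivity)
    refine h5.trans (le_of_eq ?_)
    ring
  have hA := hasSum_antidiagonal hF
  rw [hF.tsum_prod] at hA
  convert hA using 1
  · funext n
    rw [Finset.mul_sum]
    refine Finset.sum_congr rfl fun k hk => ?_
    have hk' : k ≤ n := by have := Finset.mem_range.1 hk; omega
    simp only [F, baileyCoeff]
    rw [Nat.add_sub_cancel' hk', show n - k + (2 * k + 1) = n + k + 1 by omega]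
  · rw [← tsum_mul_left]
    refine tsum_congr fun k => ?_
    rw [← durfeeSum_eq h1 (2 * k + 1), durfeeSum, ← tsum_mul_right]
    refine tsum_congr fun m => ?_
    simp only [F]
    have e : q ^ ((k + m) ^ 2 + (k + m)) * q ^ (k * (k + 1) / 2) =
        q ^ (m ^ 2 + (2 * k + 1) * m) * q ^ (3 * (k * (k + 1) / 2)) := by
      rw [← pow_add, ← pow_add]
      congr 1
      have : 2 * (k * (k + 1) / 2) = k * (k + 1) :=
        Nat.mul_div_cancel' (Nat.even_mul_succ_self k).two_dvd
      nlinarith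
    linear_combination (-((-1) ^ k * (1 - q ^ (2 * k + 1)) *
      ((qFactorial q m)⁻¹ * (qFactorial q (m + (2 * k + 1)))⁻¹) * φ k)) * e

/-- Take φ(k) = q^(-k) in `hasSum_bailey`: by `sum_baileyCoeff` only n = 0 survives. -/
theorem durfeeSum_mul_pentSum {q : ℂ} (h0 : q ≠ 0) (h1 : ‖q‖ ≤ 1 / 16) :
    durfeeSum q 0 * pentSum q = 1 := by
  have hq : ‖q‖ < 1 := h1.trans_lt (by norm_num)
  have h := hasSum_bailey h0 h1 (φ := fun k => (q ^ k)⁻¹) (M := 1) fun k => by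
    rw [mul_inv_cancel₀ (pow_ne_zero k h0), norm_one]
  refine h.unique ?_
  have h2 := hasSum_single (f := fun n => q ^ (n ^ 2 + n) *
    ∑ k ∈ Finset.range (n + 1), baileyCoeff q n k * (q ^ k)⁻¹) 0 fun n hn => by
      simp only [sum_baileyCoeff h0 hq hn, mul_zero]
  have h3 := one_sub_pow_ne_zero hq one_ne_zero
  rw [pow_one] at h3
  simpa [baileyCoeff, qFactorial, h3] using h2

/-! ### The rank series at the eighth root of unity -/

/-- The primitive eighth root of unity `(1 + i) / √2`. -/
noncomputable def zeta8 : ℂ := (√2 : ℝ) / 2 * (1 + Complex.I)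

theorem sqrt_two_mul_self : ((√2 : ℝ) : ℂ) * (√2 : ℝ) = 2 := by
  rw [← Complex.ofReal_mul, Real.mul_self_sqrt zero_le_two]; norm_num

theorem zeta8_sq : zeta8 ^ 2 = Complex.I := by
  have := sqrt_two_mul_self
  unfold zeta8
  linear_combination ((1 + Complex.I) ^ 2 / 4) * this + (1 / 2) * Complex.I_sq

theorem zeta8_pow_four : zeta8 ^ 4 = -1 := by
  rw [show 4 = 2 * 2 by rfl, pow_mul, zeta8_sq, Complex.I_sq]

theorem zeta8_pow_eight : zeta8 ^ 8 = 1 := by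
  rw [show 8 = 4 * 2 by rfl, pow_mul, zeta8_pow_four]; norm_num

theorem norm_zeta8 : ‖zeta8‖ = 1 :=
  Complex.norm_eq_one_of_pow_eq_one zeta8_pow_eight (by norm_num)

theorem zeta8_ne_zero : zeta8 ≠ 0 := norm_ne_zero_iff.1 (by rw [norm_zeta8]; exact one_ne_zero)

theorem zeta8_add_inv : zeta8 + zeta8⁻¹ = (√2 : ℝ) := by
  have h := sqrt_two_mul_self
  have h2 : zeta8⁻¹ = (√2 : ℝ) / 2 * (1 - Complex.I) := by
    refine inv_eq_of_mul_eq_one_right ?_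
    unfold zeta8
    linear_combination ((1 - Complex.I ^ 2) / 4) * h - (1 / 2) * Complex.I_sq
  rw [h2, zeta8]
  ring

theorem half_le_norm_factor {s : ℂ} (h1 : ‖s‖ ≤ 1 / 4) (k : ℕ) :
    1 / 2 ≤ ‖1 + (s ^ 2) ^ (2 * k + 1) - (s ^ 2) ^ k * ((√2 : ℝ) * s)‖ := by
  have hr := norm_nonneg s
  have hs : ‖s ^ 2‖ ≤ 1 / 16 := by rw [norm_pow]; nlinarith
  have a1 : ‖(s ^ 2) ^ (2 * k + 1)‖ ≤ 1 / 16 := by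
    rw [norm_pow]
    exact (pow_le_of_le_one (norm_nonneg _) (hs.trans (by norm_num)) (by omega)).trans hs
  have a2 : ‖(s ^ 2) ^ k * ((√2 : ℝ) * s)‖ ≤ 3 / 8 := by
    have b1 : ‖(s ^ 2) ^ k‖ ≤ 1 := by
      rw [norm_pow]
      exact pow_le_one₀ (norm_nonneg _) (hs.trans (by norm_num))
    have b2 : √2 ≤ 3 / 2 := Real.sqrt_le_iff.2 ⟨by norm_num, by norm_num⟩
    rw [norm_mul, norm_mul, Complex.norm_real, Real.norm_of_nonneg (Real.sqrt_nonneg 2)]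
    have b3 := mul_le_mul b2 h1 hr (by norm_num)
    have b4 := mul_le_mul b1 b3 (by positivity) zero_le_one
    linarith
  have c1 := norm_sub_norm_le (1 + (s ^ 2) ^ (2 * k + 1)) ((s ^ 2) ^ k * ((√2 : ℝ) * s))
  have c2 := norm_sub_norm_le (1 : ℂ) (-(s ^ 2) ^ (2 * k + 1))
  rw [norm_neg, sub_neg_eq_add, norm_one] at c2
  linarith

theorem hasSum_rankSeries {s : ℂ} (h0 : s ≠ 0) (h1 : ‖s‖ ≤ 1 / 4) :
    HasSum (fun D : ℕ => (s ^ 2) ^ (D ^ 2 + D) * ∏ k ∈ Finset.range (D + 1),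
        (1 + (s ^ 2) ^ (2 * k + 1) - (s ^ 2) ^ k * ((√2 : ℝ) * s))⁻¹)
      (durfeeSum (s ^ 2) 0 * evenLambert (s ^ 2) +
        (√2 : ℝ) * s * (durfeeSum (s ^ 2) 0 * oddLambert (s ^ 2))) := by
  have hf : ∀ k : ℕ, 1 + (s ^ 2) ^ (2 * k + 1) - (s ^ 2) ^ k * ((√2 : ℝ) * s) ≠ 0 := fun k =>
    norm_pos_iff.1 (by linarith [half_le_norm_factor h1 k])
  have hr := norm_nonneg s
  have hs : ‖s ^ 2‖ ≤ 1 / 16 := by rw [norm_pow]; nlinarith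
  have hss : (√2 : ℝ) * s * ((√2 : ℝ) * s) = 2 * s ^ 2 := by
    linear_combination (s ^ 2) * sqrt_two_mul_self
  have hq0 : s ^ 2 ≠ 0 := pow_ne_zero 2 h0
  generalize (√2 : ℝ) * s = y at *
  generalize s ^ 2 = q at *
  have hq : ‖q‖ < 1 := hs.trans_lt (by norm_num)
  have hp : ∀ n : ℕ, ‖q ^ n‖ ≤ 1 := fun n => by
    rw [norm_pow]; exact pow_le_one₀ (norm_nonneg _) hq.le
  have hd : ∀ k : ℕ, ‖(1 + q ^ (4 * k + 2))⁻¹‖ ≤ 2 := fun k => by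
    have c2 := norm_sub_norm_le (1 : ℂ) (-q ^ (4 * k + 2))
    rw [norm_neg, sub_neg_eq_add, norm_one, norm_pow] at c2
    have c3 := pow_le_of_le_one (norm_nonneg q) hq.le (show 4 * k + 2 ≠ 0 by omega)
    have c4 : (2 : ℝ)⁻¹ ≤ ‖1 + q ^ (4 * k + 2)‖ := by norm_num; linarith
    rw [norm_inv]
    exact inv_le_of_inv_le₀ (by norm_num) c4
  have e1 := hasSum_bailey hq0 hs (M := 4)
    (φ := fun k => (1 + q ^ (2 * k + 1)) / (1 + q ^ (4 * k + 2))) fun k => by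
      rw [norm_mul, div_eq_mul_inv, norm_mul]
      have c1 := norm_add_le 1 (q ^ (2 * k + 1))
      rw [norm_one] at c1
      have c2 := mul_le_mul (c1.trans (add_le_add le_rfl (hp _))) (hd k) (norm_nonneg _)
        (by norm_num)
      have c3 := mul_le_mul (hp k) c2 (by positivity) zero_le_one
      linarith
  have e2 := hasSum_bailey hq0 hs (M := 4)
    (φ := fun k => q ^ k / (1 + q ^ (4 * k + 2))) fun k => by
      rw [norm_mul, div_eq_mul_inv, norm_mul]
      have c2 := mul_le_mul (hp k) (hd k) (norm_nonneg _) zero_le_one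
      have c3 := mul_le_mul (hp k) c2 (by positivity) zero_le_one
      linarith
  refine (e1.add (e2.mul_left y)).congr_fun fun D => ?_
  rw [prod_inv_eq_sum hq0 hq hf D, mul_left_comm, ← mul_add, Finset.mul_sum _ _ y,
    ← Finset.sum_add_distrib]
  congr 1
  refine Finset.sum_congr rfl fun k _ => ?_
  have d1 := hf k
  have d2 := one_add_pow_ne_zero hq (n := 4 * k + 2) (by omega)
  -- The cross term 2 q^(2k+1) cancels against q^(2k) y^2, since y^2 = 2q.
  have d3 : (1 + q ^ (2 * k + 1) - q ^ k * y) * (1 + q ^ (2 * k + 1) + q ^ k * y) =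
      1 + q ^ (4 * k + 2) := by
    linear_combination (-(q ^ k) ^ 2) * hss
  have d4 : (1 + q ^ (2 * k + 1) - q ^ k * y)⁻¹ =
      (1 + q ^ (2 * k + 1) + q ^ k * y) / (1 + q ^ (4 * k + 2)) := by
    rw [← d3] at d2 ⊢
    rw [eq_div_iff d2, inv_mul_cancel_left₀ d1]
  rw [d4]
  ring

/-- The four components of the rank series under the rotation `s ↦ zeta8 * s`. -/
noncomputable def rankComponent (s : ℂ) : Fin 4 → ℂ :=
  ![-(2 * (s ^ 2)⁻¹ * epsSum (s ^ 2)) / charConv (evenTheta (s ^ 2)) 0,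
    2 * (s ^ 2)⁻¹ * epsConv (s ^ 2) (evenTheta (s ^ 2)) 1 / charConv (evenTheta (s ^ 2)) 0,
    (√2 : ℝ) * s * (-((s ^ 2)⁻¹ * epsSum (s ^ 2)) / charConv (oddTheta (s ^ 2)) 0),
    (√2 : ℝ) * s * ((s ^ 2)⁻¹ * (epsConv (s ^ 2) (oddTheta (s ^ 2)) 0 -
      charConv (oddTheta (s ^ 2)) 0) / charConv (oddTheta (s ^ 2)) 0)]

/-- The exponents of the rotation characters of `rankComponent`. -/
def rankWeight : Fin 4 → ℕ := ![0, 2, 1, 7]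

theorem rankComponent_zeta8_mul {s : ℂ} (h0 : s ≠ 0) (h1 : ‖s‖ ≤ 1 / 4) (i : Fin 4) :
    rankComponent (zeta8 * s) i = zeta8 ^ rankWeight i * rankComponent s i := by
  have hs0 : s ^ 2 ≠ 0 := pow_ne_zero 2 h0
  have hs : ‖s ^ 2‖ < 1 := by rw [norm_pow]; nlinarith [norm_nonneg s]
  have h7 : zeta8 ^ 7 = zeta8 * Complex.I ^ 3 := by rw [← zeta8_sq]; ring
  have hI : Complex.I⁻¹ * Complex.I = 1 := inv_mul_cancel₀ Complex.I_ne_zero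
  fin_cases i <;>
    simp only [rankComponent, rankWeight, mul_pow, zeta8_sq, Fin.zero_eta, Fin.mk_one,
      Fin.reduceFinMk, Matrix.cons_val, Matrix.cons_val_zero, Matrix.cons_val_one, pow_zero,
      pow_one, one_mul, h7, epsSum_I_mul hs0 hs, charConv_evenTheta_I_mul hs0,
      epsConv_evenTheta_I_mul hs0, charConv_oddTheta_I_mul hs0, epsConv_oddTheta_I_mul hs0,
      mul_inv]
  · simp only [Complex.inv_I]
    linear_combination (2 * (s ^ 2)⁻¹ * epsSum (s ^ 2) /
      charConv (evenTheta (s ^ 2)) 0) * Complex.I_sq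
  · simp only [Complex.inv_I]; ring
  · simp only [Complex.inv_I]
    linear_combination ((√2 : ℝ) * zeta8 * s * (s ^ 2)⁻¹ * epsSum (s ^ 2) /
      charConv (oddTheta (s ^ 2)) 0) * Complex.I_sq
  · simp only [Complex.inv_I, Complex.I_pow_three]; ring

/-- In both Lambert identities the factor `pentSum` cancels against `durfeeSum`, leaving quotients
whose behaviour under rotation is known. -/
theorem hasSum_rankComponent {s : ℂ} (h0 : s ≠ 0) (h1 : ‖s‖ ≤ 1 / 4) :
    HasSum (fun D : ℕ => (s ^ 2) ^ (D ^ 2 + D) * ∏ k ∈ Finset.range (D + 1),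
        (1 + (s ^ 2) ^ (2 * k + 1) - (s ^ 2) ^ k * ((√2 : ℝ) * s))⁻¹)
      (∑ i, rankComponent s i) := by
  have h := hasSum_rankSeries h0 h1
  have hs0 : s ^ 2 ≠ 0 := pow_ne_zero 2 h0
  have hs : ‖s ^ 2‖ ≤ 1 / 16 := by rw [norm_pow]; nlinarith [norm_nonneg s]
  have hs1 : ‖s ^ 2‖ < 1 := hs.trans_lt (by norm_num)
  have hP := durfeeSum_mul_pentSum hs0 hs
  have hC := charConv_evenTheta_ne_zero hs0 hs
  have hD := charConv_oddTheta_ne_zero hs0 hs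
  have e1 := charConv_mul_evenLambert hs0 hs1
  have e2 := charConv_mul_oddLambert hs0 hs1
  convert h using 1
  have f1 : durfeeSum (s ^ 2) 0 * evenLambert (s ^ 2) = -(2 * (s ^ 2)⁻¹ *
      (epsSum (s ^ 2) - epsConv (s ^ 2) (evenTheta (s ^ 2)) 1)) /
        charConv (evenTheta (s ^ 2)) 0 := by
    rw [eq_div_iff hC]
    linear_combination durfeeSum (s ^ 2) 0 * e1 - (2 * (s ^ 2)⁻¹ *
      (epsSum (s ^ 2) - epsConv (s ^ 2) (evenTheta (s ^ 2)) 1)) * hP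
  have f2 : durfeeSum (s ^ 2) 0 * oddLambert (s ^ 2) = -((s ^ 2)⁻¹ *
      (epsSum (s ^ 2) - (epsConv (s ^ 2) (oddTheta (s ^ 2)) 0 -
        charConv (oddTheta (s ^ 2)) 0))) / charConv (oddTheta (s ^ 2)) 0 := by
    rw [eq_div_iff hD]
    linear_combination durfeeSum (s ^ 2) 0 * e2 - ((s ^ 2)⁻¹ *
      (epsSum (s ^ 2) - (epsConv (s ^ 2) (oddTheta (s ^ 2)) 0 -
        charConv (oddTheta (s ^ 2)) 0))) * hP
  rw [f1, f2]
  simp only [rankComponent, Fin.sum_univ_four, Matrix.cons_val, Matrix.cons_val_zero,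
    Matrix.cons_val_one]
  ring

/-! ### Filtering coefficients by rotation -/

/-- The operator f(s) ↦ f(ζs) - v_i f(s) multiplies the nth coefficient by ζ^n - v_i and the
component A_j by v_j - v_i. The components need not be power series themselves. -/
theorem hasSum_prod_sub {ι : Type*} {r : ℝ} {ζ : ℂ} (hζ : ‖ζ‖ = 1) {A : ℂ → ι → ℂ} {v : ι → ℂ}
    (t : Finset ι) (hA : ∀ s, s ≠ 0 → ‖s‖ ≤ r → ∀ i, A (ζ * s) i = v i * A s i) {c : ℕ → ℂ}
    (hc : ∀ s, s ≠ 0 → ‖s‖ ≤ r → HasSum (fun n => c n * s ^ n) (∑ i ∈ t, A s i))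
    (u : Finset ι) {s : ℂ} (h0 : s ≠ 0) (hs : ‖s‖ ≤ r) :
    HasSum (fun n => (c n * ∏ i ∈ u, (ζ ^ n - v i)) * s ^ n)
      (∑ j ∈ t, (∏ i ∈ u, (v j - v i)) * A s j) := by
  classical
  have hζ0 : ζ ≠ 0 := norm_ne_zero_iff.1 (by rw [hζ]; exact one_ne_zero)
  induction u using Finset.induction_on generalizing s with
  | empty => simpa using hc s h0 hs
  | insert a u ha ih =>
    have h1 := ih (mul_ne_zero hζ0 h0) (by rwa [norm_mul, hζ, one_mul])
    have h2 := (ih h0 hs).mul_left (v a)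
    rw [Finset.mul_sum] at h2
    have h3 := h1.sub h2
    rw [← Finset.sum_sub_distrib] at h3
    have e : ∑ j ∈ t, (∏ i ∈ insert a u, (v j - v i)) * A s j =
        ∑ j ∈ t, ((∏ i ∈ u, (v j - v i)) * A (ζ * s) j -
          v a * ((∏ i ∈ u, (v j - v i)) * A s j)) := by
      refine Finset.sum_congr rfl fun j _ => ?_
      rw [Finset.prod_insert ha, hA s h0 hs]
      ring
    rw [e]
    refine h3.congr_fun fun n => ?_
    rw [Finset.prod_insert ha, mul_pow]
    ring

theorem eq_zero_of_hasSum_zero {c : ℕ → ℂ} {r : ℝ} (hr : 0 < r)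
    (h : ∀ s, ‖s‖ ≤ r → HasSum (fun n => c n * s ^ n) 0) (n : ℕ) : c n = 0 := by
  have hp : HasFPowerSeriesAt (fun _ : ℂ => (0 : ℂ)) (FormalMultilinearSeries.ofScalars ℂ c) 0 := by
    rw [hasFPowerSeriesAt_iff]
    filter_upwards [Metric.closedBall_mem_nhds (0 : ℂ) hr] with s hs
    refine (h s (by simpa using hs)).congr_fun fun n => ?_
    rw [FormalMultilinearSeries.coeff_ofScalars, smul_eq_mul, mul_comm]
  have := congrArg (fun p => p.coeff n) hp.eq_zero
  rw [FormalMultilinearSeries.coeff_ofScalars] at this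
  simpa [FormalMultilinearSeries.coeff] using this

/-- Applying all four operators annihilates every component, so c(n) ∏ (ζ^n - v_i) = 0 for every n.
-/
theorem coeff_rankSeries_eq_zero {c : ℕ → ℂ}
    (hc : ∀ s : ℂ, s ≠ 0 → ‖s‖ ≤ 1 / 4 → ∃ g, HasSum (fun n => c n * s ^ n) g ∧
      HasSum (fun D : ℕ => (s ^ 2) ^ (D ^ 2 + D) * ∏ k ∈ Finset.range (D + 1),
        (1 + (s ^ 2) ^ (2 * k + 1) - (s ^ 2) ^ k * ((√2 : ℝ) * s))⁻¹) g)
    {n : ℕ} (hn : ∀ i, zeta8 ^ n ≠ zeta8 ^ rankWeight i) : c n = 0 := by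
  have key : ∀ s : ℂ, ‖s‖ ≤ 1 / 4 →
      HasSum (fun n => (c n * ∏ i, (zeta8 ^ n - zeta8 ^ rankWeight i)) * s ^ n) 0 := by
    intro s hs
    rcases eq_or_ne s 0 with rfl | h0
    -- The components are controlled only for s ≠ 0; at s = 0 just the constant term remains, and it
    -- vanishes because 0 is among the weights.
    · convert hasSum_zero (α := ℂ) (β := ℕ) using 2 with n
      rcases Nat.eq_zero_or_pos n with rfl | hn
      · rw [Finset.prod_eq_zero (Finset.mem_univ (0 : Fin 4)) (by simp [rankWeight])]
        ring
      · rw [zero_pow hn.ne', mul_zero]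
    · have := hasSum_prod_sub (A := rankComponent) (v := fun i => zeta8 ^ rankWeight i)
        (c := c) (r := 1 / 4) norm_zeta8 Finset.univ
        (fun s h0 hs i => rankComponent_zeta8_mul h0 hs i) (fun s h0 hs => by
          obtain ⟨g, h1, h2⟩ := hc s h0 hs
          rwa [(hasSum_rankComponent h0 hs).unique h2]) Finset.univ h0 hs
      convert this using 1
      refine (Finset.sum_eq_zero fun j _ => ?_).symm
      rw [Finset.prod_eq_zero (Finset.mem_univ j) (sub_self _), zero_mul]
  have h := eq_zero_of_hasSum_zero (by norm_num) key n
  exact (mul_eq_zero.1 h).resolve_right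
    (Finset.prod_ne_zero_iff.2 fun i _ => sub_ne_zero.2 (hn i))

/-! ### Generating functions of rows and of symbols -/

/-- The multisets of odd positive integers less than `2 * N`. -/
abbrev OddRow (N : ℕ) := {m : Multiset ℕ // ∀ a ∈ m, ∃ k < N, a = 2 * k + 1}

namespace OddRow

/-- Adding copies of the next admissible part to a row. -/
def succEquiv (N : ℕ) : ℕ × OddRow N ≃ OddRow (N + 1) where
  toFun p := ⟨Multiset.replicate p.1 (2 * N + 1) + p.2.1, fun a ha => by
    rcases Multiset.mem_add.1 ha with h | h
    · exact ⟨N, N.lt_succ_self, Multiset.eq_of_mem_replicate h⟩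
    · obtain ⟨k, hk, e⟩ := p.2.2 a h
      exact ⟨k, hk.trans N.lt_succ_self, e⟩⟩
  invFun m := ⟨m.1.count (2 * N + 1), m.1.filter fun a => ¬ a = 2 * N + 1, fun a ha => by
    obtain ⟨h1, h2⟩ := Multiset.mem_filter.1 ha
    obtain ⟨k, hk, e⟩ := m.2 a h1
    exact ⟨k, by omega, e⟩⟩
  left_inv := by
    rintro ⟨j, m, hm⟩
    have hN : 2 * N + 1 ∉ m := fun h => by
      obtain ⟨k, hk, e⟩ := hm _ h
      omega
    refine Prod.ext ?_ (Subtype.ext ?_)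
    · simp [Multiset.count_eq_zero_of_notMem hN]
    · have h1 : (Multiset.replicate j (2 * N + 1)).filter (fun a => ¬ a = 2 * N + 1) = 0 :=
        Multiset.filter_eq_nil.2 fun a ha => not_not.2 (Multiset.eq_of_mem_replicate ha)
      have h2 : m.filter (fun a => ¬ a = 2 * N + 1) = m :=
        Multiset.filter_eq_self.2 fun a ha e => hN (e ▸ ha)
      simp only [Multiset.filter_add, h1, h2, zero_add]
  right_inv := by
    rintro ⟨m, hm⟩
    refine Subtype.ext ?_
    change Multiset.replicate (m.count (2 * N + 1)) (2 * N + 1) +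
      m.filter (fun a => ¬ a = 2 * N + 1) = m
    rw [← Multiset.filter_eq', Multiset.filter_add_not]

variable {𝕜 : Type*} [NormedField 𝕜]

/-- The weight `z ^ length * s ^ size` of a row. -/
def weight (z s : 𝕜) {N : ℕ} (m : OddRow N) : 𝕜 := z ^ Multiset.card m.1 * s ^ m.1.sum

theorem weight_succEquiv (z s : 𝕜) {N : ℕ} (p : ℕ × OddRow N) :
    weight z s (succEquiv N p) = (z * s ^ (2 * N + 1)) ^ p.1 * weight z s p.2 := by
  simp only [weight, succEquiv, Equiv.coe_fn_mk, Multiset.card_add, Multiset.card_replicate,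
    Multiset.sum_add, Multiset.sum_replicate, pow_add, mul_pow, smul_eq_mul, ← pow_mul]
  rw [mul_comm p.1]
  ring

theorem norm_weight (z s : 𝕜) {N : ℕ} (m : OddRow N) : ‖weight z s m‖ = weight ‖z‖ ‖s‖ m := by
  simp [weight]

/-- Each new part size contributes an independent geometric series, through `succEquiv`. -/
theorem hasSum_weight [CompleteSpace 𝕜] {z s : 𝕜} (hz : ‖z‖ = 1) (hs : ‖s‖ < 1) (N : ℕ) :
    (Summable fun m : OddRow N => ‖weight z s m‖) ∧
    HasSum (fun m : OddRow N => weight z s m)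
      (∏ k ∈ Finset.range N, (1 - z * s ^ (2 * k + 1))⁻¹) := by
  induction N with
  | zero =>
    have : Unique (OddRow 0) :=
      ⟨⟨⟨0, by simp⟩⟩, fun m => Subtype.ext (Multiset.eq_zero_of_forall_notMem fun a ha => by
        obtain ⟨k, hk, -⟩ := m.2 a ha
        omega)⟩
    refine ⟨(hasSum_unique _).summable, ?_⟩
    have h := hasSum_unique fun m : OddRow 0 => weight z s m
    have hd : (default : OddRow 0).1 = 0 := Multiset.eq_zero_of_forall_notMem fun a ha => by
        obtain ⟨k, hk, -⟩ := (default : OddRow 0).2 a ha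
        omega
    simpa [weight, hd] using h
  | succ N ih =>
    have hx : ‖z * s ^ (2 * N + 1)‖ < 1 := by
      rw [norm_mul, hz, one_mul, norm_pow]
      exact pow_lt_one₀ (norm_nonneg _) hs (by omega)
    have hg := hasSum_geometric_of_norm_lt_one hx
    have hgn : Summable fun j : ℕ => ‖(z * s ^ (2 * N + 1)) ^ j‖ := by
      simp only [norm_pow]
      exact summable_geometric_of_lt_one (norm_nonneg _) hx
    have hn := hgn.mul_norm ih.1
    refine ⟨(succEquiv N).summable_iff.1 (hn.congr fun p => ?_), (succEquiv N).hasSum_iff.1 ?_⟩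
    · rw [Function.comp_apply, weight_succEquiv]
    · rw [Finset.prod_range_succ, mul_comm]
      refine (hg.mul ih.2 hn.of_norm).congr_fun fun p => ?_
      rw [Function.comp_apply, weight_succEquiv]

end OddRow

namespace OddDurfeeSymbol

noncomputable instance (n : ℕ) : Fintype (OddDurfeeSymbol n) := Fintype.ofFinite _

theorem mem_oddRow {m : Multiset ℕ} {D : ℕ} (h1 : ∀ a ∈ m, Odd a) (h2 : ∀ a ∈ m, a ≤ 2 * D + 1) :
    ∀ a ∈ m, ∃ k < D + 1, a = 2 * k + 1 := fun a ha => by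
  obtain ⟨k, hk⟩ := h1 a ha
  have := h2 a ha
  exact ⟨k, by omega, hk⟩

/-- An odd Durfee symbol of some integer is a subscript together with two rows. -/
def sigmaEquiv : (Σ n, OddDurfeeSymbol n) ≃ Σ D, OddRow (D + 1) × OddRow (D + 1) where
  toFun x := ⟨x.2.D, ⟨x.2.top, mem_oddRow x.2.top_odd x.2.top_le⟩,
    ⟨x.2.bot, mem_oddRow x.2.bot_odd x.2.bot_le⟩⟩
  invFun y := ⟨y.2.1.1.sum + y.2.2.1.sum + (2 * y.1 ^ 2 + 2 * y.1 + 1), {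
    D := y.1
    top := y.2.1.1
    bot := y.2.2.1
    top_odd := fun a ha => by obtain ⟨k, -, e⟩ := y.2.1.2 a ha; exact ⟨k, e⟩
    bot_odd := fun a ha => by obtain ⟨k, -, e⟩ := y.2.2.2 a ha; exact ⟨k, e⟩
    top_le := fun a ha => by obtain ⟨k, h, e⟩ := y.2.1.2 a ha; omega
    bot_le := fun a ha => by obtain ⟨k, h, e⟩ := y.2.2.2 a ha; omega
    sum_eq := rfl }⟩
  left_inv := by
    rintro ⟨n, D, t, b, h1, h2, h3, h4, rfl⟩
    rfl
  right_inv := fun _ => rfl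

theorem summable_weight {s : ℂ} (h1 : ‖s‖ ≤ 1 / 4) :
    Summable fun y : Σ D, OddRow (D + 1) × OddRow (D + 1) =>
      s ^ (2 * y.1 ^ 2 + 2 * y.1 + 1) *
        (OddRow.weight zeta8 s y.2.1 * OddRow.weight zeta8⁻¹ s y.2.2) := by
  have hr := norm_nonneg s
  have hs : ‖s‖ < 1 := h1.trans_lt (by norm_num)
  have hw := fun N => (OddRow.hasSum_weight (𝕜 := ℝ) norm_one
    (by rwa [norm_norm] : ‖(‖s‖)‖ < 1) N)
  have hp : ∀ D : ℕ, HasSum (fun p : OddRow (D + 1) × OddRow (D + 1) =>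
      ‖s ^ (2 * D ^ 2 + 2 * D + 1) *
        (OddRow.weight zeta8 s p.1 * OddRow.weight zeta8⁻¹ s p.2)‖)
      (‖s‖ ^ (2 * D ^ 2 + 2 * D + 1) *
        ((∏ k ∈ Finset.range (D + 1), (1 - 1 * ‖s‖ ^ (2 * k + 1))⁻¹) *
        ∏ k ∈ Finset.range (D + 1), (1 - 1 * ‖s‖ ^ (2 * k + 1))⁻¹)) := by
    intro D
    have h := (((hw (D + 1)).2.mul (hw (D + 1)).2
      ((hw (D + 1)).1.mul_norm (hw (D + 1)).1).of_norm).mul_left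
        (‖s‖ ^ (2 * D ^ 2 + 2 * D + 1)))
    refine h.congr_fun fun p => ?_
    rw [norm_mul, norm_mul, OddRow.norm_weight, OddRow.norm_weight, norm_inv, norm_zeta8, inv_one,
      norm_pow]
  refine Summable.of_norm ((summable_sigma_of_nonneg fun _ => norm_nonneg _).2
    ⟨fun D => (hp D).summable, ?_⟩)
  simp only [fun D => (hp D).tsum_eq]
  have hb : ∀ N, ∏ k ∈ Finset.range N, (1 - 1 * ‖s‖ ^ (2 * k + 1))⁻¹ ≤ (4 / 3 : ℝ) ^ N ∧
      0 ≤ ∏ k ∈ Finset.range N, (1 - 1 * ‖s‖ ^ (2 * k + 1))⁻¹ := by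
    intro N
    have hk : ∀ k : ℕ, (3 / 4 : ℝ) ≤ 1 - 1 * ‖s‖ ^ (2 * k + 1) := fun k => by
      have := pow_le_of_le_one hr hs.le (show 2 * k + 1 ≠ 0 by omega)
      linarith
    have h0 : ∀ k ∈ Finset.range N, 0 ≤ (1 - 1 * ‖s‖ ^ (2 * k + 1))⁻¹ := fun k _ =>
      inv_nonneg.2 (by linarith [hk k])
    refine ⟨?_, Finset.prod_nonneg h0⟩
    have := Finset.prod_le_prod (g := fun _ => (4 / 3 : ℝ)) h0 fun k _ =>
      inv_le_of_inv_le₀ (by norm_num) (by norm_num; linarith [hk k])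
    rwa [Finset.prod_const, Finset.card_range] at this
  -- The ratio is (1/16)(4/3)^2 = 1/9; the two products have D + 1 factors, hence the extra (4/3)^2
  -- = 16/9.
  refine Summable.of_nonneg_of_le (fun D => by have := (hb (D + 1)).2; positivity) (fun D => ?_)
    ((summable_geometric_of_lt_one (r := (1 / 9 : ℝ)) (by norm_num) (by norm_num)).mul_left
      (16 / 9))
  obtain ⟨b1, b2⟩ := hb (D + 1)
  have b3 := mul_le_mul b1 b1 b2 (by positivity)
  have b4 : ‖s‖ ^ (2 * D ^ 2 + 2 * D + 1) ≤ (1 / 16) ^ D := by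
    calc ‖s‖ ^ (2 * D ^ 2 + 2 * D + 1) ≤ ‖s‖ ^ (2 * D) :=
          pow_le_pow_of_le_one hr hs.le (by omega)
      _ ≤ (1 / 4) ^ (2 * D) := pow_le_pow_left₀ hr h1 _
      _ = _ := by rw [pow_mul]; norm_num
  refine (mul_le_mul b4 b3 (by positivity) (by positivity)).trans (le_of_eq ?_)
  rw [← mul_pow, pow_succ, ← mul_assoc, ← mul_pow]
  norm_num
  ring

/-- The number of odd Durfee symbols of `n` weighted by `zeta8 ^ oddRank`. -/
noncomputable def rankSum (n : ℕ) : ℂ := ∑ x : OddDurfeeSymbol n, zeta8 ^ x.oddRank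

/-- One summable family, indexed by symbols, is summed by size and by subscript. Dividing by s
leaves an even power s^(2D^2+2D) and shifts the index to n + 1. -/
theorem hasSum_rankSum {s : ℂ} (h0 : s ≠ 0) (h1 : ‖s‖ ≤ 1 / 4) :
    ∃ g, HasSum (fun n => rankSum (n + 1) * s ^ n) g ∧
      HasSum (fun D : ℕ => (s ^ 2) ^ (D ^ 2 + D) * ∏ k ∈ Finset.range (D + 1),
        (1 + (s ^ 2) ^ (2 * k + 1) - (s ^ 2) ^ k * ((√2 : ℝ) * s))⁻¹) g := by
  have hs : ‖s‖ < 1 := h1.trans_lt (by norm_num)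
  have hF := (summable_weight h1).hasSum
  generalize (∑' y : Σ D, OddRow (D + 1) × OddRow (D + 1), s ^ (2 * y.1 ^ 2 + 2 * y.1 + 1) *
        (OddRow.weight zeta8 s y.2.1 * OddRow.weight zeta8⁻¹ s y.2.2)) = T at hF
  refine ⟨s⁻¹ * T, ?_, ?_⟩
  · have h2 := (sigmaEquiv.hasSum_iff.2 hF).sigma fun n => hasSum_fintype _
    have h3 : HasSum (fun n => rankSum n * s ^ n) T := by
      refine h2.congr_fun fun n => ?_
      rw [rankSum, Finset.sum_mul]
      refine Finset.sum_congr rfl fun x _ => ?_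
      have e : s ^ n = s ^ (2 * x.D ^ 2 + 2 * x.D + 1) * (s ^ x.top.sum * s ^ x.bot.sum) := by
        rw [← pow_add, ← pow_add, add_comm, x.sum_eq]
      rw [oddRank, zpow_sub₀ zeta8_ne_zero, zpow_natCast, zpow_natCast, e]
      simp only [Function.comp_apply, sigmaEquiv, Equiv.coe_fn_mk, OddRow.weight, inv_pow]
      ring
    have h4 : rankSum 0 = 0 := Finset.sum_eq_zero fun x _ => absurd x.sum_eq (by omega)
    have h5 := (hasSum_nat_add_iff' 1).2 h3
    rw [Finset.sum_range_one, h4, zero_mul, sub_zero] at h5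
    refine (h5.mul_left s⁻¹).congr_fun fun n => ?_
    rw [pow_succ]
    field_simp
  · have h2 := hF.sigma fun D => (((OddRow.hasSum_weight norm_zeta8 hs (D + 1)).2.mul
      (OddRow.hasSum_weight (by rw [norm_inv, norm_zeta8, inv_one]) hs (D + 1)).2
      ((OddRow.hasSum_weight norm_zeta8 hs (D + 1)).1.mul_norm
        (OddRow.hasSum_weight (by rw [norm_inv, norm_zeta8, inv_one]) hs (D + 1)).1).of_norm
      ).mul_left (s ^ (2 * D ^ 2 + 2 * D + 1)))
    refine (h2.mul_left s⁻¹).congr_fun fun D => ?_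
    rw [← Finset.prod_mul_distrib]
    have e : s ^ (2 * D ^ 2 + 2 * D + 1) = s * (s ^ 2) ^ (D ^ 2 + D) := by
      rw [← pow_mul, pow_succ]; ring
    rw [e, mul_assoc s, inv_mul_cancel_left₀ h0]
    congr 1
    refine Finset.prod_congr rfl fun k _ => ?_
    rw [← mul_inv]
    congr 1
    have := mul_inv_cancel₀ zeta8_ne_zero
    rw [← zeta8_add_inv]
    linear_combination (-(s ^ (2 * k + 1)) ^ 2) * this

/-! ### Vanishing of the rank sums and extraction of the counts -/

theorem isPrimitiveRoot_zeta8 : IsPrimitiveRoot zeta8 8 := by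
  have := orderOf_eq_prime_pow (p := 2) (n := 2) (x := zeta8)
    (by norm_num [zeta8_pow_four]) (by norm_num [zeta8_pow_eight])
  exact IsPrimitiveRoot.iff_orderOf.2 this

/-- After the shift by one, n - 1 is congruent to 3, 4, 5 or 6 modulo 8, none of which is a rotation
weight 0, 1, 2, 7. -/
theorem rankSum_eq_zero {n : ℕ} (hn : 4 ≤ n % 8) : rankSum n = 0 := by
  obtain ⟨m, rfl⟩ : ∃ m, n = m + 1 := ⟨n - 1, by omega⟩
  refine coeff_rankSeries_eq_zero (c := fun n => rankSum (n + 1))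
    (fun s h0 h1 => hasSum_rankSum h0 h1) fun i h => ?_
  have h2 : zeta8 ^ ((m : ℤ) - rankWeight i) = 1 := by
    rw [zpow_sub₀ zeta8_ne_zero, zpow_natCast, zpow_natCast, h,
      div_self (pow_ne_zero _ zeta8_ne_zero)]
  rw [isPrimitiveRoot_zeta8.zpow_eq_one_iff_dvd] at h2
  fin_cases i <;> simp [rankWeight] at h2 <;> omega

theorem zeta8_zpow_re (r : ℤ) : (zeta8 ^ r).re =
    (if r ≡ 0 [ZMOD 8] then 1 else 0) - (if r ≡ 4 [ZMOD 8] then 1 else 0) +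
    √2 / 2 * ((if r ≡ 1 [ZMOD 8] then 1 else 0) + (if r ≡ 7 [ZMOD 8] then 1 else 0) -
      (if r ≡ 3 [ZMOD 8] then 1 else 0) - (if r ≡ 5 [ZMOD 8] then 1 else 0)) := by
  have h : zeta8 ^ r = zeta8 ^ (r % 8).toNat := by
    have e : ((r % 8).toNat : ℤ) = r % 8 := Int.toNat_of_nonneg (Int.emod_nonneg _ (by norm_num))
    conv_lhs => rw [← Int.mul_ediv_add_emod r 8, zpow_add₀ zeta8_ne_zero, zpow_mul]
    rw [show (zeta8 ^ (8 : ℤ)) = zeta8 ^ 8 from zpow_natCast _ 8, zeta8_pow_eight, one_zpow,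
      one_mul, ← e, zpow_natCast, e]
  have hre : zeta8.re = √2 / 2 := by simp [zeta8]
  have him : zeta8.im = √2 / 2 := by simp [zeta8]
  have h3 : zeta8 ^ 3 = Complex.I * zeta8 := by rw [← zeta8_sq]; ring
  have h5 : zeta8 ^ 5 = -zeta8 := by rw [pow_succ, zeta8_pow_four]; ring
  have h6 : zeta8 ^ 6 = -Complex.I := by
    rw [show 6 = 4 + 2 by rfl, pow_add, zeta8_pow_four, zeta8_sq]; ring
  have h7 : zeta8 ^ 7 = -(Complex.I * zeta8) := by
    rw [show 7 = 4 + 3 by rfl, pow_add, zeta8_pow_four, h3]; ring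
  rw [h]
  unfold Int.ModEq
  have : r % 8 = 0 ∨ r % 8 = 1 ∨ r % 8 = 2 ∨ r % 8 = 3 ∨ r % 8 = 4 ∨ r % 8 = 5 ∨ r % 8 = 6 ∨
    r % 8 = 7 := by omega
  rcases this with e | e | e | e | e | e | e | e <;>
    simp [e, h3, h5, h6, h7, zeta8_sq, zeta8_pow_four, hre, him]

theorem sum_ite_oddRank (a M : ℤ) (n : ℕ) :
    ∑ x : OddDurfeeSymbol n, (if x.oddRank ≡ a [ZMOD M] then (1 : ℝ) else 0) =
      oddRankCount a M n := by
  classical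
  rw [Finset.sum_boole, oddRankCount, Nat.card_eq_fintype_card, Fintype.card_subtype]

/-- Ranks congruent to 2 or 6 contribute purely imaginary terms, so they drop out. -/
theorem re_rankSum (n : ℕ) : (rankSum n).re = (oddRankCount 0 8 n - oddRankCount 4 8 n : ℝ) +
    √2 / 2 * (oddRankCount 1 8 n + oddRankCount 7 8 n - oddRankCount 3 8 n -
      oddRankCount 5 8 n) := by
  simp only [rankSum, Complex.re_sum, zeta8_zpow_re, ← sum_ite_oddRank, Finset.sum_add_distrib,
    Finset.sum_sub_distrib, ← Finset.mul_sum]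

theorem sum_mod_two {m : Multiset ℕ} (h : ∀ a ∈ m, Odd a) : m.sum % 2 = Multiset.card m % 2 := by
  induction m using Multiset.induction_on with
  | empty => rfl
  | cons a m ih =>
    have h1 := ih fun b hb => h b (Multiset.mem_cons_of_mem hb)
    obtain ⟨k, hk⟩ := h a (Multiset.mem_cons_self a m)
    rw [Multiset.sum_cons, Multiset.card_cons]
    omega

/-- All entries are odd and 2D^2 + 2D + 1 is odd, so n - 1 has the parity of the total number of
entries, hence of the rank. -/
theorem oddRank_emod_two {n : ℕ} (x : OddDurfeeSymbol n) : x.oddRank % 2 = ((n : ℤ) + 1) % 2 := by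
  have h1 := sum_mod_two x.top_odd
  have h2 := sum_mod_two x.bot_odd
  have h3 := x.sum_eq
  unfold oddRank
  omega

theorem oddRankCount_eq_zero {n : ℕ} {a : ℤ} (h : (a + n) % 2 = 0) : oddRankCount a 8 n = 0 := by
  rw [oddRankCount, Nat.card_eq_zero]
  refine Or.inl ⟨fun ⟨x, hx⟩ => ?_⟩
  have := x.oddRank_emod_two
  unfold Int.ModEq at hx
  omega

/-- Exchanging the two rows. -/
def swap {n : ℕ} : OddDurfeeSymbol n ≃ OddDurfeeSymbol n where
  toFun x := ⟨x.D, x.bot, x.top, x.bot_odd, x.top_odd, x.bot_le, x.top_le, by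
    rw [add_comm x.bot.sum, x.sum_eq]⟩
  invFun x := ⟨x.D, x.bot, x.top, x.bot_odd, x.top_odd, x.bot_le, x.top_le, by
    rw [add_comm x.bot.sum, x.sum_eq]⟩
  left_inv _ := rfl
  right_inv _ := rfl

theorem oddRankCount_eq_of_add {a b : ℤ} (h : a + b ≡ 0 [ZMOD 8]) (n : ℕ) :
    oddRankCount a 8 n = oddRankCount b 8 n := by
  refine Nat.card_congr (swap.subtypeEquiv fun x => ?_)
  have : (swap x).oddRank = -x.oddRank := by simp [swap, oddRank]
  rw [this]
  unfold Int.ModEq at *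
  omega

end OddDurfeeSymbol

theorem mainTheorem8 (n : ℕ) :
    (∀ r ∈ ({5, 7} : Set ℕ), oddRankCount 0 8 (8 * n + r) = oddRankCount 4 8 (8 * n + r)) ∧
    (∀ r ∈ ({4, 6} : Set ℕ), oddRankCount 1 8 (8 * n + r) = oddRankCount 3 8 (8 * n + r)) := by
  constructor
  · intro r hr
    have hr' : r = 5 ∨ r = 7 := hr
    have h := OddDurfeeSymbol.re_rankSum (8 * n + r)
    rw [OddDurfeeSymbol.rankSum_eq_zero (by omega)] at h
    rw [OddDurfeeSymbol.oddRankCount_eq_zero (a := 1) (by push_cast; omega),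
      OddDurfeeSymbol.oddRankCount_eq_zero (a := 7) (by push_cast; omega),
      OddDurfeeSymbol.oddRankCount_eq_zero (a := 3) (by push_cast; omega),
      OddDurfeeSymbol.oddRankCount_eq_zero (a := 5) (by push_cast; omega)] at h
    simp only [Complex.zero_re, Nat.cast_zero, add_zero, sub_zero, mul_zero] at h
    exact_mod_cast (sub_eq_zero.1 h.symm)
  · intro r hr
    have hr' : r = 4 ∨ r = 6 := hr
    have h := OddDurfeeSymbol.re_rankSum (8 * n + r)
    rw [OddDurfeeSymbol.rankSum_eq_zero (by omega),
      OddDurfeeSymbol.oddRankCount_eq_zero (a := 0) (by push_cast; omega),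
      OddDurfeeSymbol.oddRankCount_eq_zero (a := 4) (by push_cast; omega),
      OddDurfeeSymbol.oddRankCount_eq_of_add (a := 7) (b := 1) (by decide),
      OddDurfeeSymbol.oddRankCount_eq_of_add (a := 5) (b := 3) (by decide)] at h
    have h2 : 0 < √2 := Real.sqrt_pos.2 two_pos
    have h3 : (oddRankCount 1 8 (8 * n + r) : ℝ) = oddRankCount 3 8 (8 * n + r) := by
      simp only [Complex.zero_re, Nat.cast_zero, sub_zero, zero_add] at h
      rcases mul_eq_zero.1 h.symm with h | h <;> linarith
    exact_mod_cast h3
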